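/- Let $I=[0,1]$ with Lebesgue measure $\lambda$, and let $\mathcal A^{\rm mp}$ be the set of maps $f:I\to I$ that are Lebesgue measurable, preserve $\lambda$ (i.e. $\lambda(f^{-1}(S))=\lambda(S)$ for all measurable $S$) and are almost aperiodic (i.e. $\lambda$-almost every $x\in I$ is aperiodic, meaning that its orbit $\{x,f(x),f^2(x),\dots\}$ is infinite). The order pattern of a tuple $(y_1,\dots,y_n)$ of distinct elements of a totally ordered set is the permutation $\sigma\in S_n$ with $\sigma(i)<\sigma(j)\iff y_i<y_j$. For $f\in\mathcal A^{\rm mp}$ let $\mu_n(f)$ be the probability distribution on $S_n$ given by $\mu_n(f)(\sigma)=\lambda\{x \text{ aperiodic}: (x,f(x),\dots,f^{n-1}(x)) \text{ has order pattern } \sigma\}$. For $k\ge 0$ the permutation digraph $G_k$ has vertex set $S_k$ and edge set $S_{k+1}$, where $\tau\in S_{k+1}$ is an edge from the order pattern of $(\tau(1),\dots,\tau(k))$ to that of $(\tau(2),\dots,\tau(k+1))$. A loop is a finite directed path $\gamma=(v_0,e_1,v_1,\dots,e_\ell,v_\ell)$ with $v_0=v_\ell$; it is based at $v_0$ and may repeat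 vertices and edges. For a path in $G_k$ let $\le$ be the partial order on symbols $x_1,\dots,x_{\ell+k}$ generated by: $x_{a+c}\le x_{a+d}$ if $0\le a\le\ell$, $c,d\in\{1,\dots,k\}$ and $v_a(c)\le v_a(d)$; and $x_{a-1+c}\le x_{a-1+d}$ if $1\le a\le \ell$, $c,d\in\{1,\dots,k+1\}$ and $e_a(c)\le e_a(d)$. For a loop $\gamma$ of length $\ell\ge1$ and $j\in\{1,\dots,k\}$ let $\mathrm{Drift}_\gamma(j)$ be $+$ if $x_j\le x_{\ell+j}$, $-$ if $x_j\ge x_{\ell+j}$, and $0$ otherwise. A strongly connected subgraph $K\subseteq G_k$ drifts if there are a vertex $v$ of $K$, $j\in\{1,\dots,k\}$ and $\epsilon\in\{+,-\}$ such that $\mathrm{Drift}_\gamma(j)=\epsilon$ for every loop $\gamma$ of length $\ge 1$ in $K$ based at $v$. A face subgraph of $G_k$ is a subgraph without isolated vertices in which every edge lies on a loop of the subgraph (so its connected components are strongly connected). A face subgraph is driftless if none of its connected components drifts. Let $n\ge1$. Let $P_n$ be the polytope of flows on $G_{n-1}$: the functions $\phi:S_n\to[0,1]$ on the edges with $\sum_e\phi(e)=1$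 such that at every vertex the sum of $\phi$ over outgoing edges equals the sum over incoming edges. For a face subgraph $H\subseteq G_{n-1}$ let $F_H$ be the set of flows in $P_n$ that vanish on all edges outside $H$. An open face is the relative interior $\mathrm{Int}(F)$ of a face $F$ (the empty face and $P_n$ itself count as faces). Then: 1. The set $\mu_n(\mathcal A^{\rm mp})=\{\mu_n(f): f\in\mathcal A^{\rm mp}\}$ is a union of open faces of $P_n$. 2. For every face subgraph $H$ the set $F_H$ is a face of $P_n$, and for every face $F$ of $P_n$ there is exactly one face subgraph $H$ of $G_{n-1}$ with $F=F_H$. For every face subgraph $H$, $\mathrm{Int}(F_H)\subseteq\mu_n(\mathcal A^{\rm mp})$ if and only if $H$ is driftless. 3. The closure of $\mu_n(\mathcal A^{\rm mp})$ is $P_n$. -/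

import Mathlib

open MeasureTheory Equiv

noncomputable section

namespace OrderPatterns

/-! ### Order patterns -/

/-- The order pattern of an `n`-tuple `y` (of pairwise distinct elements of a linear order): the
permutation `σ` with `y i < y j ↔ σ i < σ j`, i.e. `y (σ⁻¹ 0) < y (σ⁻¹ 1) < ⋯`
(see `orderPattern_lt_iff`). -/
def orderPattern {n : ℕ} {α : Type*} [LinearOrder α] (y : Fin n → α) : Perm (Fin n) :=
  (Tuple.sort y).symm

/-- The defining property of the order pattern. -/
theorem orderPattern_lt_iff {n : ℕ} {α : Type*} [LinearOrder α] (y : Fin n → α)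
    (hy : Function.Injective y) (i j : Fin n) :
    orderPattern y i < orderPattern y j ↔ y i < y j := by
  have h : StrictMono (y ∘ Tuple.sort y) :=
    (Tuple.monotone_sort y).strictMono_of_injective (hy.comp (Tuple.sort y).injective)
  have := h.lt_iff_lt (a := orderPattern y i) (b := orderPattern y j)
  simpa [orderPattern] using this.symm

/-- `ρ(σ)`: the order pattern of `σ` restricted to the first `n` indices. -/
def rho {n : ℕ} (σ : Perm (Fin (n + 1))) : Perm (Fin n) :=
  orderPattern fun i : Fin n => σ i.castSucc

/-- `ρ'(σ)`: the order pattern of `σ` restricted to the last `n` indices. -/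
def rho' {n : ℕ} (σ : Perm (Fin (n + 1))) : Perm (Fin n) :=
  orderPattern fun i : Fin n => σ i.succ

/-! ### Interval maps and their distributions of order patterns -/

/-- `x` is aperiodic for `f`: its orbit is infinite. -/
def IsAperiodicPt {α : Type*} (f : α → α) (x : α) : Prop :=
  (Set.range fun k : ℕ => f^[k] x).Infinite

/-- The almost aperiodic maps of `[0,1]` that are Lebesgue measurable and preserve Lebesgue
measure. -/
def aperiodicMeasurePreserving : Set (unitInterval → unitInterval) :=
  {f | (∀ᵐ x ∂(volume : Measure unitInterval), IsAperiodicPt f x) ∧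
    NullMeasurable f (volume : Measure unitInterval) ∧
    ∀ S : Set unitInterval, MeasurableSet S → volume (f ⁻¹' S) = volume S}

/-- `μ_n(f)(σ)`: the Lebesgue measure of the set of aperiodic points `x` for which
`(x, f x, …, f^{n-1} x)` has order pattern `σ`. -/
def orderDist (n : ℕ) (f : unitInterval → unitInterval) : Perm (Fin n) → ℝ := fun σ =>
  (volume : Measure unitInterval).real
    {x | IsAperiodicPt f x ∧ orderPattern (fun i : Fin n => f^[(i : ℕ)] x) = σ}

/-- The set of order-pattern distributions `μ_n(f)`, for `f` an almost aperiodic measure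
preserving map. -/
def realizable (n : ℕ) : Set (Perm (Fin n) → ℝ) :=
  orderDist n '' aperiodicMeasurePreserving

/-! ### Digraphs, paths, subgraphs -/

/-- A digraph with vertex set `V` and edge set `E` (loops and multiple edges allowed); an edge `e`
is traversed from `head e` to `tail e`. -/
structure MultiDigraph (V E : Type*) where
  head : E → V
  tail : E → V

namespace MultiDigraph

variable {V E : Type*} (G : MultiDigraph V E)

/-- A finite path `(v₀, e₁, v₁, …, e_ℓ, v_ℓ)`; here `edge i` is `e_{i+1}`. -/
structure Path where
  length : ℕ
  vert : Fin (length + 1) → V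
  edge : Fin length → E
  head_edge : ∀ i, G.head (edge i) = vert i.castSucc
  tail_edge : ∀ i, G.tail (edge i) = vert i.succ

/-- `p` is a loop based at `v`. -/
def Path.IsLoopAt {G : MultiDigraph V E} (p : G.Path) (v : V) : Prop :=
  p.vert 0 = v ∧ p.vert (Fin.last p.length) = v

/-- A subgraph: sets of vertices and edges, containing the endpoints of its edges. -/
@[ext]
structure Subgraph where
  verts : Set V
  edges : Set E
  head_mem : ∀ e ∈ edges, G.head e ∈ verts
  tail_mem : ∀ e ∈ edges, G.tail e ∈ verts

variable {G}

/-- The path `p` lies in the subgraph `H`. -/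
def Path.IsIn (p : G.Path) (H : G.Subgraph) : Prop :=
  (∀ i, p.vert i ∈ H.verts) ∧ ∀ i, p.edge i ∈ H.edges

/-- A face subgraph: every edge lies on a loop in the subgraph, and there are no isolated
vertices. -/
def Subgraph.IsFaceSubgraph (H : G.Subgraph) : Prop :=
  (∀ v ∈ H.verts, ∃ e ∈ H.edges, G.head e = v ∨ G.tail e = v) ∧
    ∀ e ∈ H.edges, ∃ (v : V) (γ : G.Path), γ.IsLoopAt v ∧ γ.IsIn H ∧ ∃ i, γ.edge i = e

/-- There is an edge of `H` from `u` to `w`. -/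
def Subgraph.Adj (H : G.Subgraph) (u w : V) : Prop :=
  ∃ e ∈ H.edges, G.head e = u ∧ G.tail e = w

/-- The connected component of the vertex `v` in `H` (edge directions being ignored; in a face
subgraph each component is strongly connected). -/
def Subgraph.component (H : G.Subgraph) (v : V) : G.Subgraph where
  verts := {w | w ∈ H.verts ∧ Relation.EqvGen H.Adj v w}
  edges := {e | e ∈ H.edges ∧ Relation.EqvGen H.Adj v (G.head e)}
  head_mem := fun e he => ⟨H.head_mem e he.1, he.2⟩
  tail_mem := fun e he => ⟨H.tail_mem e he.1,
    Relation.EqvGen.trans _ _ _ he.2 (Relation.EqvGen.rel _ _ ⟨e, he.1, rfl, rfl⟩)⟩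

/-- The polytope of flows on `G`: edge weightings, nonnegative with total mass `1`, for which at
each vertex the outgoing mass equals the incoming mass. -/
def flowPolytope [Fintype E] [DecidableEq V] (G : MultiDigraph V E) : Set (E → ℝ) :=
  {φ | φ ∈ stdSimplex ℝ E ∧ ∀ v : V, ∑ e with G.head e = v, φ e = ∑ e with G.tail e = v, φ e}

/-- `F_H`: the flows supported on the subgraph `H`. -/
def Subgraph.face [Fintype E] [DecidableEq V] (H : G.Subgraph) : Set (E → ℝ) :=
  {φ | φ ∈ G.flowPolytope ∧ ∀ e, e ∉ H.edges → φ e = 0}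

end MultiDigraph

/-! ### The permutation digraph, the poset of a path, and drift -/

/-- The permutation digraph `G_n = (S_n, S_{n+1}, ρ, ρ')`. -/
def permDigraph (n : ℕ) : MultiDigraph (Perm (Fin n)) (Perm (Fin (n + 1))) where
  head := rho
  tail := rho'

/-- The generating relations of the poset `Q_p` of a path `p` of length `ℓ` in `G_n`. Its elements
`x_0, …, x_{ℓ+n-1}` (indexed from `0`) are represented by their indices; the `c`-th entry of the
vertex `v_k` is `x_{k+c}`, and so is the `c`-th entry of the edge from `v_k` to `v_{k+1}`. -/
inductive PosetStep {n : ℕ} (p : (permDigraph n).Path) : ℕ → ℕ → Prop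
  | vert (k : Fin (p.length + 1)) (c d : Fin n) (h : p.vert k c ≤ p.vert k d) :
      PosetStep p (k + c) (k + d)
  | edge (k : Fin p.length) (c d : Fin (n + 1)) (h : p.edge k c ≤ p.edge k d) :
      PosetStep p (k + c) (k + d)

/-- `x_i ≤ x_j` in the poset `Q_p`. -/
def PosetLE {n : ℕ} (p : (permDigraph n).Path) : ℕ → ℕ → Prop :=
  Relation.ReflTransGen (PosetStep p)

open Classical in
/-- `Drift_γ(i, j)` for a loop `γ` of length `ℓ` in `G_n`, comparing `x_i` with
`y_j = x_{ℓ+j}`; the signs `+`, `-` are written `1`, `-1`. -/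
def drift {n : ℕ} (γ : (permDigraph n).Path) (i j : Fin n) : SignType :=
  if PosetLE γ i (γ.length + j) then 1
  else if PosetLE γ (γ.length + j) i then -1
  else 0

/-- A strongly connected subgraph `K` of `G_n` drifts: for some vertex `v` of `K`, some `j` and some
sign `ε = ±`, each (nontrivial) loop in `K` based at `v` satisfies `Drift_γ(j, j) = ε`. -/
def ConnectedDrifts {n : ℕ} (K : (permDigraph n).Subgraph) : Prop :=
  ∃ v ∈ K.verts, ∃ (j : Fin n) (ε : SignType), ε ≠ 0 ∧
    ∀ γ : (permDigraph n).Path, γ.IsLoopAt v → γ.IsIn K → 0 < γ.length → drift γ j j = ε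

/-- A face subgraph is driftless if none of its connected components drifts. -/
def Driftless {n : ℕ} (H : (permDigraph n).Subgraph) : Prop :=
  ¬ ∃ v ∈ H.verts, ConnectedDrifts (H.component v)

end OrderPatterns

end

/-! Invariance of the measure makes the pattern process along an orbit stationary, so the pattern
distribution is a flow, and a flow lies in the open face given by its support. The faces are the
sets F_H, and the relative interior of F_H consists of the flows positive on all edges of H. The
question is therefore which H support a realizable flow.

Drift is an obstruction (`driftless_supportSubgraph`). If every loop at v moves the j-th entry of
the window in one fixed direction, then each return of an orbit to the pattern v moves that entry
strictly in this direction. Poincaré recurrence for the sets "pattern v, entry below the rational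
level q" forces it to come back.

Without drift every flow positive on H is realizable (`Driftless.mem_realizable`). Call a loop at v
separating if no entry of its first window is comparable with an entry of its last window. Loops
that violate the possible drifts can be concatenated so as to destroy these comparabilities one
entry at a time (`exists_isSeparating`). Because its end windows are independent, a separating loop
can bridge the end and the start of any other loop g at v: the separating loop followed by g is
traced by a periodic sequence (`IsSeparating.isCyclic_append`). A periodic sequence becomes an
interval map that permutes subintervals cyclically, with an irrational rotation inside each to make
orbits infinite (`mem_realizable_of_isCyclic`). A flow positive on H contains a small multiple of
all the separating loops; the rest decomposes into loops of H, and any positive share of a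
separating loop suffices to make one of these cyclic (`IsSeparating.add_mem_cyclicCone`).

For the closure, the whole digraph is driftless, since any pattern can be repeated with copies
moving up or with copies moving down, and flows positive on every edge are dense in the polytope. -/

noncomputable section

namespace OrderPatterns

namespace MultiDigraph

variable {V E : Type*} {G : MultiDigraph V E}

/-! ### Walks as lists of edges -/

/-- `l` is the list of edges of a walk from `u` to `w`. -/
def IsWalk (G : MultiDigraph V E) : V → List E → V → Prop
  | u, [], w => u = w
  | u, e :: l, w => G.head e = u ∧ IsWalk G (G.tail e) l w

theorem IsWalk.append {u v w : V} {l₁ l₂ : List E} (h₁ : G.IsWalk u l₁ v) (h₂ : G.IsWalk v l₂ w) :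
    G.IsWalk u (l₁ ++ l₂) w := by
  induction l₁ generalizing u with
  | nil => cases h₁; exact h₂
  | cons e l ih => exact ⟨h₁.1, ih h₁.2⟩

theorem IsWalk.exists_verts {u w : V} {l : List E} (h : G.IsWalk u l w) :
    ∃ x : ℕ → V, x 0 = u ∧ x l.length = w ∧
      ∀ i (hi : i < l.length), G.head l[i] = x i ∧ G.tail l[i] = x (i + 1) := by
  induction l generalizing u with
  | nil => exact ⟨fun _ => u, rfl, h, by simp⟩
  | cons e l ih =>
    obtain ⟨x, hx0, hx1, hx⟩ := ih h.2
    refine ⟨fun i => Nat.casesOn i u x, rfl, hx1, ?_⟩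
    rintro (_ | i) hi
    · exact ⟨h.1, hx0.symm⟩
    · exact hx i (by simpa using hi)

theorem isWalk_of_verts {l : List E} {x : ℕ → V}
    (hx : ∀ i (hi : i < l.length), G.head l[i] = x i ∧ G.tail l[i] = x (i + 1)) :
    G.IsWalk (x 0) l (x l.length) := by
  induction l generalizing x with
  | nil => rfl
  | cons e l ih =>
    refine ⟨(hx 0 (by simp)).1, ?_⟩
    have h0 : G.tail e = x 1 := (hx 0 (by simp)).2
    rw [h0]
    exact ih (x := fun i => x (i + 1)) fun i hi => hx (i + 1) (by simpa using hi)

theorem IsWalk.tail_getElem_last {u w : V} {l : List E} (h : G.IsWalk u l w) (i : ℕ)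
    (hi : i + 1 = l.length) : G.tail (l[i]'(by omega)) = w := by
  obtain ⟨x, -, h1, hx⟩ := h.exists_verts
  rw [(hx i (by omega)).2, hi, h1]

/-- The list of edges of a path. -/
def Path.edges (p : G.Path) : List E := List.ofFn p.edge

theorem Path.isWalk_edges (p : G.Path) : G.IsWalk (p.vert 0) p.edges (p.vert (Fin.last _)) := by
  have := isWalk_of_verts (G := G) (l := p.edges)
    (x := fun i => if h : i < p.length + 1 then p.vert ⟨i, h⟩ else p.vert 0) (by
      intro i hi
      have hi' : i < p.length := by simpa [Path.edges] using hi
      have h1 := p.head_edge ⟨i, hi'⟩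
      have h2 := p.tail_edge ⟨i, hi'⟩
      constructor
      · rw [dif_pos (by omega)]; simpa [Path.edges] using h1
      · rw [dif_pos (by omega)]; simpa [Path.edges] using h2)
  simpa [Path.edges, Fin.last] using this

/-- The path along the first `n` steps of an infinite sequence of vertices and edges. -/
def Path.ofSeq (x : ℕ → V) (e : ℕ → E) (n : ℕ)
    (h : ∀ i < n, G.head (e i) = x i ∧ G.tail (e i) = x (i + 1)) : G.Path where
  length := n
  vert i := x i
  edge i := e i
  head_edge i := (h i i.2).1
  tail_edge i := (h i i.2).2

theorem IsWalk.exists_path {u w : V} {l : List E} (h : G.IsWalk u l w) :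
    ∃ p : G.Path, p.vert 0 = u ∧ p.vert (Fin.last _) = w ∧ p.edges = l := by
  obtain ⟨x, h0, h1, hx⟩ := h.exists_verts
  refine ⟨⟨l.length, fun i => x i, fun i => l[i], fun i => (hx i i.2).1, fun i => (hx i i.2).2⟩,
    h0, h1, ?_⟩
  simp [Path.edges]

theorem Path.isIn_of_edges (p : G.Path) (H : G.Subgraph) (h0 : p.vert 0 ∈ H.verts)
    (h : ∀ e ∈ p.edges, e ∈ H.edges) : p.IsIn H := by
  have he : ∀ i, p.edge i ∈ H.edges := fun i => h _ (by simp [Path.edges])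
  refine ⟨fun i => ?_, he⟩
  induction i using Fin.cases with
  | zero => exact h0
  | succ i => rw [← p.tail_edge]; exact H.tail_mem _ (he i)

theorem IsWalk.mem_component {H : G.Subgraph} {v u w : V} {l : List E} (h : G.IsWalk u l w)
    (hl : ∀ e ∈ l, e ∈ H.edges) (hv : Relation.EqvGen H.Adj v u) :
    ∀ e ∈ l, e ∈ (H.component v).edges := by
  induction l generalizing u with
  | nil => simp
  | cons e l ih =>
    have he := hl e (by simp)
    intro e' he'
    rcases List.mem_cons.1 he' with rfl | he'
    · exact ⟨he, by rw [h.1]; exact hv⟩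
    · exact ih h.2 (fun e' he' => hl e' (by simp [he']))
        (hv.trans _ _ _ (.rel _ _ ⟨e, he, h.1, rfl⟩)) _ he'

/-! ### Flows -/

/-- The vector counting how often each edge is used in a list. -/
def countVec (l : List E) : E → ℝ := by
  classical exact fun e => (l.count e : ℝ)

theorem countVec_nil : countVec ([] : List E) = 0 := by
  ext; simp [countVec]

theorem countVec_append (l₁ l₂ : List E) : countVec (l₁ ++ l₂) = countVec l₁ + countVec l₂ := by
  ext; simp [countVec]

theorem countVec_nonneg (l : List E) (e : E) : 0 ≤ countVec l e := by
  simp [countVec]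

theorem countVec_pos_iff {l : List E} {e : E} : 0 < countVec l e ↔ e ∈ l := by
  simp [countVec, List.count_pos_iff]

theorem countVec_eq_zero {l : List E} {e : E} (h : e ∉ l) : countVec l e = 0 := by
  by_contra hne
  exact h (countVec_pos_iff.1 ((countVec_nonneg l e).lt_of_ne (Ne.symm hne)))

theorem sum_countVec [Fintype E] (l : List E) (s : E → Prop) [DecidablePred s] :
    ∑ e with s e, countVec l e = l.countP (fun e => decide (s e)) := by
  classical
  induction l with
  | nil => simp [countVec]
  | cons a l ih =>
    rw [← List.singleton_append, countVec_append]
    simp only [Pi.add_apply, Finset.sum_add_distrib, ih, List.countP_append, Nat.cast_add]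
    congr 1
    simp only [countVec, List.count_singleton, List.countP_singleton, Finset.sum_filter]
    by_cases h : s a
    · rw [Finset.sum_eq_single a]
      · simp [h]
      · intro b _ hb; simp [Ne.symm hb]
      · simp
    · rw [Finset.sum_eq_zero]
      · simp [h]
      · intro b _
        by_cases hb : a = b <;> simp_all

theorem IsWalk.countP_head [DecidableEq V] {u w : V} {l : List E} (h : G.IsWalk u l w) (v : V) :
    l.countP (fun e => decide (G.head e = v)) + (if w = v then 1 else 0) =
      l.countP (fun e => decide (G.tail e = v)) + (if u = v then 1 else 0) := by
  induction l generalizing u with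
  | nil => cases h; simp
  | cons e l ih =>
    have := ih h.2
    have h1 := h.1
    simp only [List.countP_cons, decide_eq_true_eq, h1]
    omega

theorem Subgraph.IsFaceSubgraph.ext_edges {H K : G.Subgraph} (hH : H.IsFaceSubgraph)
    (hK : K.IsFaceSubgraph) (h : H.edges = K.edges) : H = K := by
  refine Subgraph.ext ?_ h
  have key : ∀ {H K : G.Subgraph}, H.IsFaceSubgraph → H.edges = K.edges → H.verts ⊆ K.verts := by
    intro H K hH h v hv
    obtain ⟨e, he, h1 | h1⟩ := hH.1 v hv
    · rw [← h1]; exact K.head_mem e (h ▸ he)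
    · rw [← h1]; exact K.tail_mem e (h ▸ he)
  exact (key hH h).antisymm (key hK h.symm)

theorem Subgraph.IsFaceSubgraph.exists_walk {H : G.Subgraph} (hH : H.IsFaceSubgraph) {e : E}
    (he : e ∈ H.edges) :
    ∃ l, (∃ v, G.IsWalk v l v) ∧ (∀ a ∈ l, a ∈ H.edges) ∧ e ∈ l := by
  obtain ⟨v, γ, hγ, hγH, i, rfl⟩ := hH.2 e he
  refine ⟨γ.edges, ⟨v, ?_⟩, fun a ha => ?_, by simp [Path.edges]⟩
  · have := γ.isWalk_edges
    rwa [hγ.1, hγ.2] at this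
  · obtain ⟨i, rfl⟩ : ∃ i, γ.edge i = a := by simpa [Path.edges] using ha
    exact hγH.2 i

variable [Fintype E] [DecidableEq V]

/-- Conservation of `ψ` at every vertex. -/
def IsFlow (G : MultiDigraph V E) (ψ : E → ℝ) : Prop :=
  ∀ v : V, ∑ e with G.head e = v, ψ e = ∑ e with G.tail e = v, ψ e

theorem IsFlow.add {ψ χ : E → ℝ} (h : G.IsFlow ψ) (h' : G.IsFlow χ) : G.IsFlow (ψ + χ) := by
  intro v; simp [Finset.sum_add_distrib, h v, h' v]

theorem IsFlow.smul {ψ : E → ℝ} (h : G.IsFlow ψ) (c : ℝ) : G.IsFlow (c • ψ) := by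
  intro v; simp [← Finset.mul_sum, h v]

theorem IsFlow.sub {ψ χ : E → ℝ} (h : G.IsFlow ψ) (h' : G.IsFlow χ) : G.IsFlow (ψ - χ) := by
  intro v; simp [Finset.sum_sub_distrib, h v, h' v]

theorem IsFlow.sum {ι : Type*} (s : Finset ι) {ψ : ι → E → ℝ} (h : ∀ i ∈ s, G.IsFlow (ψ i)) :
    G.IsFlow (∑ i ∈ s, ψ i) := by
  intro v
  simp only [Finset.sum_apply]
  rw [Finset.sum_comm, Finset.sum_comm (s := Finset.univ.filter _) (t := s)]
  exact Finset.sum_congr rfl fun i hi => h i hi v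

theorem IsWalk.isFlow_countVec {v : V} {l : List E} (h : G.IsWalk v l v) :
    G.IsFlow (countVec l) := by
  intro x
  rw [sum_countVec, sum_countVec]
  have := h.countP_head x
  exact_mod_cast Nat.add_right_cancel this

/-- Let `R` be the set of vertices reachable from the end of `e` along positive edges. No positive
edge leaves `R`, so by conservation summed over `R` none enters it either. As `e` ends in `R`, it
also starts there. -/
theorem IsFlow.exists_walk [Fintype V] {ψ : E → ℝ} (h : G.IsFlow ψ) (h0 : ∀ e, 0 ≤ ψ e) {e : E}
    (he : 0 < ψ e) : ∃ l, G.IsWalk (G.tail e) l (G.head e) ∧ ∀ e' ∈ l, 0 < ψ e' := by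
  classical
  set R : Finset V := {v | ∃ l, G.IsWalk (G.tail e) l v ∧ ∀ e' ∈ l, 0 < ψ e'} with hR
  have hsum : ∀ g : E → V, ∑ v ∈ R, ∑ e with g e = v, ψ e = ∑ e, if g e ∈ R then ψ e else 0 := by
    intro g
    simp only [Finset.sum_filter]
    rw [Finset.sum_comm]
    simp
  have key : ∑ e, ((if G.tail e ∈ R then ψ e else 0) - (if G.head e ∈ R then ψ e else 0)) = 0 := by
    rw [Finset.sum_sub_distrib, ← hsum, ← hsum, sub_eq_zero]
    exact Finset.sum_congr rfl fun v _ => (h v).symm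
  have hstep : ∀ e', 0 < ψ e' → G.head e' ∈ R → G.tail e' ∈ R := by
    intro e' he' hm
    simp only [hR, Finset.mem_filter, Finset.mem_univ, true_and] at hm ⊢
    obtain ⟨l, hl, hl'⟩ := hm
    refine ⟨l ++ [e'], hl.append ⟨rfl, rfl⟩, ?_⟩
    intro a ha
    rcases List.mem_append.1 ha with ha | ha
    · exact hl' a ha
    · rw [List.mem_singleton.1 ha]; exact he'
  rw [Finset.sum_eq_zero_iff_of_nonneg] at key
  · have h1 := key e (Finset.mem_univ _)
    have h2 : G.tail e ∈ R := by
      simp only [hR, Finset.mem_filter, Finset.mem_univ, true_and]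
      exact ⟨[], rfl, by simp⟩
    rw [if_pos h2] at h1
    by_cases h3 : G.head e ∈ R
    · simpa [hR] using h3
    · rw [if_neg h3] at h1; linarith
  · intro e' _
    rcases (h0 e').lt_or_eq with h' | h'
    · have := hstep e' h'
      split_ifs <;> first | tauto | linarith
    · simp [← h']

/-- A nonnegative flow is a nonnegative combination of loops in its support. -/
theorem IsFlow.mem_span [Fintype V] {ψ : E → ℝ} (h : G.IsFlow ψ) (h0 : ∀ e, 0 ≤ ψ e) :
    ψ ∈ Submodule.span NNReal
      {χ | ∃ v l, G.IsWalk v l v ∧ l ≠ [] ∧ (∀ e ∈ l, 0 < ψ e) ∧ χ = countVec l} := by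
  classical
  induction hn : (Finset.univ.filter fun e => 0 < ψ e).card using Nat.strong_induction_on
    generalizing ψ with
  | _ n ih =>
  by_cases hz : ∃ e, 0 < ψ e
  · obtain ⟨e, he⟩ := hz
    obtain ⟨l', hl', hp'⟩ := h.exists_walk h0 he
    set l := e :: l' with hl
    have hw : G.IsWalk (G.head e) l (G.head e) := ⟨rfl, hl'⟩
    have hp : ∀ a ∈ l, 0 < ψ a := by
      intro a ha
      rcases List.mem_cons.1 ha with rfl | ha
      · exact he
      · exact hp' a ha
    -- The least ratio `t` of weight to multiplicity is the largest multiple of the loop that can be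
    -- subtracted; the minimizing edge `a` then leaves the support, which drives the induction.
    obtain ⟨a, ha, hmin⟩ := Finset.exists_min_image l.toFinset (fun a => ψ a / countVec l a)
      ⟨e, by simp [hl]⟩
    rw [List.mem_toFinset] at ha
    have hca := countVec_pos_iff.2 ha
    set t := ψ a / countVec l a with ht
    have ht0 : 0 < t := div_pos (hp a ha) hca
    have hle : ∀ b, t * countVec l b ≤ ψ b := by
      intro b
      by_cases hb : b ∈ l
      · have := hmin b (by simpa using hb)
        rwa [le_div_iff₀ (countVec_pos_iff.2 hb)] at this
      · rw [countVec_eq_zero hb, mul_zero]; exact h0 b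
    have hflow : G.IsFlow (ψ - t • countVec l) := h.sub (hw.isFlow_countVec.smul t)
    have hsub : ∀ b, 0 < (ψ - t • countVec l) b → 0 < ψ b := by
      intro b hb
      have := mul_nonneg ht0.le (countVec_nonneg l b)
      simp only [Pi.sub_apply, Pi.smul_apply, smul_eq_mul] at hb
      linarith
    have hcard : (Finset.univ.filter fun e => 0 < (ψ - t • countVec l) e).card < n := by
      rw [← hn]
      apply Finset.card_lt_card
      rw [Finset.ssubset_iff_of_subset]
      · refine ⟨a, by simpa using hp a ha, ?_⟩
        have : t * countVec l a = ψ a := by rw [ht]; field_simp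
        simp [this]
      · intro b; simpa using hsub b
    have := ih _ hcard hflow (by intro b; simpa using hle b) rfl
    have h2 : ψ = (ψ - t • countVec l) + (⟨t, ht0.le⟩ : NNReal) • countVec l := by
      ext b; simp
    rw [h2]
    refine Submodule.add_mem _ (Submodule.span_mono ?_ this)
      (Submodule.smul_mem _ _ (Submodule.subset_span ⟨_, l, hw, by simp [hl], ?_, rfl⟩))
    · rintro χ ⟨v, k, hk, hk0, hk', rfl⟩
      refine ⟨v, k, hk, hk0, fun b hb => ?_, rfl⟩
      rw [← h2]; exact hsub b (hk' b hb)
    · rw [← h2]; exact hp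
  · have : ψ = 0 := by
      ext e; exact le_antisymm (not_lt.1 fun h => hz ⟨e, h⟩) (h0 e)
    rw [this]; exact Submodule.zero_mem _

/-! ### Faces of the flow polytope -/

theorem mem_flowPolytope {φ : E → ℝ} :
    φ ∈ G.flowPolytope ↔ (∀ e, 0 ≤ φ e) ∧ ∑ e, φ e = 1 ∧ G.IsFlow φ := by
  simp [flowPolytope, stdSimplex, IsFlow, and_assoc]

/-- The subgraph on which `φ` is positive. -/
def supportSubgraph (G : MultiDigraph V E) (φ : E → ℝ) : G.Subgraph where
  verts := {v | ∃ e, 0 < φ e ∧ (G.head e = v ∨ G.tail e = v)}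
  edges := {e | 0 < φ e}
  head_mem e he := ⟨e, he, .inl rfl⟩
  tail_mem e he := ⟨e, he, .inr rfl⟩

theorem IsFlow.isFaceSubgraph [Fintype V] {φ : E → ℝ} (h : G.IsFlow φ) (h0 : ∀ e, 0 ≤ φ e) :
    (G.supportSubgraph φ).IsFaceSubgraph := by
  refine ⟨fun v hv => hv, fun e he => ?_⟩
  obtain ⟨l, hl, hp⟩ := h.exists_walk h0 he
  have hw : G.IsWalk (G.head e) (e :: l) (G.head e) := ⟨rfl, hl⟩
  obtain ⟨p, hp0, hp1, hpe⟩ := hw.exists_path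
  refine ⟨G.head e, p, ⟨hp0, hp1⟩, p.isIn_of_edges _ ?_ ?_, ?_⟩
  · rw [hp0]; exact ⟨e, he, .inl rfl⟩
  · rw [hpe]
    intro a ha
    rcases List.mem_cons.1 ha with rfl | ha
    · exact he
    · exact hp a ha
  · have : e ∈ p.edges := by rw [hpe]; simp
    simpa [Path.edges] using this

theorem Subgraph.IsFaceSubgraph.eq_supportSubgraph [Fintype V] {H : G.Subgraph}
    (hH : H.IsFaceSubgraph) {φ : E → ℝ} (hφ : φ ∈ H.face) (hp : ∀ e ∈ H.edges, 0 < φ e) :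
    H = G.supportSubgraph φ := by
  obtain ⟨h0, -, h1⟩ := mem_flowPolytope.1 hφ.1
  refine hH.ext_edges (h1.isFaceSubgraph h0) ?_
  ext e
  refine ⟨hp e, fun he => ?_⟩
  by_contra h
  exact absurd (hφ.2 e h) (ne_of_gt he)

/-- A face subgraph with an edge carries a flow that is positive on all its edges. -/
theorem Subgraph.IsFaceSubgraph.exists_pos {H : G.Subgraph} (hH : H.IsFaceSubgraph)
    (hne : H.edges.Nonempty) : ∃ φ ∈ H.face, ∀ e ∈ H.edges, 0 < φ e := by
  classical
  choose! γ hγ hγH hmem using fun e => hH.exists_walk (e := e)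
  set ψ : E → ℝ := ∑ e with e ∈ H.edges, countVec (γ e) with hψ
  have hflow : G.IsFlow ψ := by
    refine IsFlow.sum _ fun e he => ?_
    have he' : e ∈ H.edges := by simpa using he
    exact (hγ e he').choose_spec.isFlow_countVec
  have h0 : ∀ a, 0 ≤ ψ a := by
    intro a
    rw [hψ, Finset.sum_apply]
    exact Finset.sum_nonneg fun e _ => countVec_nonneg _ _
  have hpos : ∀ a ∈ H.edges, 0 < ψ a := by
    intro a ha
    rw [hψ, Finset.sum_apply]
    refine Finset.sum_pos' (fun e _ => countVec_nonneg _ _) ⟨a, by simpa using ha, ?_⟩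
    exact countVec_pos_iff.2 (hmem a ha)
  have hvan : ∀ a, a ∉ H.edges → ψ a = 0 := by
    intro a ha
    rw [hψ, Finset.sum_apply]
    refine Finset.sum_eq_zero fun e he => countVec_eq_zero fun h => ha ?_
    have he' : e ∈ H.edges := by simpa using he
    exact hγH e he' a h
  obtain ⟨e₀, he₀⟩ := hne
  have hs : 0 < ∑ e, ψ e := Finset.sum_pos' (fun e _ => h0 e) ⟨e₀, Finset.mem_univ _, hpos _ he₀⟩
  refine ⟨(∑ e, ψ e)⁻¹ • ψ, ⟨mem_flowPolytope.2 ⟨fun e => ?_, ?_, hflow.smul _⟩, fun e he => ?_⟩,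
    fun e he => ?_⟩
  · exact mul_nonneg (inv_nonneg.2 hs.le) (h0 e)
  · simp only [Pi.smul_apply, smul_eq_mul, ← Finset.mul_sum]
    exact inv_mul_cancel₀ hs.ne'
  · simp [hvan e he]
  · exact mul_pos (inv_pos.2 hs) (hpos e he)

theorem Subgraph.face_edges_nonempty {H : G.Subgraph} {φ : E → ℝ} (h : φ ∈ H.face) :
    H.edges.Nonempty := by
  by_contra hne
  rw [Set.not_nonempty_iff_eq_empty] at hne
  have h0 : ∀ e, φ e = 0 := fun e => h.2 e (by simp [hne])
  have := (mem_flowPolytope.1 h.1).2.1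
  simp [h0] at this

/-- The exposing functional is minus the mass carried off `H`: it is nonpositive on the polytope,
and any point of the face shows that its maximum is 0. -/
theorem Subgraph.isExposed_face (H : G.Subgraph) : IsExposed ℝ G.flowPolytope H.face := by
  classical
  rintro ⟨φ, hφ⟩
  let L : (E → ℝ) →L[ℝ] ℝ := -∑ e with e ∉ H.edges, ContinuousLinearMap.proj e
  have hL : ∀ ψ, L ψ = -∑ e with e ∉ H.edges, ψ e := by
    intro ψ
    simp [L]
  have hφ0 : L φ = 0 := by
    rw [hL, Finset.sum_eq_zero, neg_zero]
    intro e he; exact hφ.2 e (by simpa using he)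
  refine ⟨L, Set.ext fun ψ => ⟨fun hψ => ⟨hψ.1, fun χ hχ => ?_⟩, fun hψ => ⟨hψ.1, fun e he => ?_⟩⟩⟩
  · have : L ψ = 0 := by
      rw [hL, Finset.sum_eq_zero, neg_zero]
      intro e he; exact hψ.2 e (by simpa using he)
    rw [this, hL, neg_nonpos]
    exact Finset.sum_nonneg fun e _ => (mem_flowPolytope.1 hχ).1 e
  · have h1 := hψ.2 φ hφ.1
    rw [hφ0, hL, Left.nonneg_neg_iff] at h1
    have h2 : ∀ a ∈ Finset.univ.filter (· ∉ H.edges), 0 ≤ ψ a :=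
      fun a _ => (mem_flowPolytope.1 hψ.1).1 a
    exact (Finset.sum_eq_zero_iff_of_nonneg h2).1 (h1.antisymm (Finset.sum_nonneg h2)) e
      (by simpa using he)

/-- Past a point `φ` of a face with full support one can move a little further away from any other
point of the face. -/
theorem exists_extend_mem_flowPolytope {φ ψ : E → ℝ} (hφ : φ ∈ G.flowPolytope)
    (hψ : ψ ∈ G.flowPolytope) (hs : ∀ e, φ e = 0 → ψ e = 0) :
    ∃ t : ℝ, 0 < t ∧ φ + t • (φ - ψ) ∈ G.flowPolytope := by
  obtain ⟨a0, a1, a2⟩ := mem_flowPolytope.1 hφ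
  obtain ⟨b0, b1, b2⟩ := mem_flowPolytope.1 hψ
  have hev : ∀ e, ∀ᶠ t in nhdsWithin (0 : ℝ) (Set.Ioi 0), 0 ≤ (φ + t • (φ - ψ)) e := by
    intro e
    rcases (a0 e).lt_or_eq with h | h
    · have hc : Filter.Tendsto (fun t : ℝ => φ e + t * (φ e - ψ e)) (nhdsWithin 0 (Set.Ioi 0))
          (nhds (φ e + 0 * (φ e - ψ e))) :=
        ((continuous_const.add (continuous_id.mul continuous_const)).tendsto 0).mono_left
          nhdsWithin_le_nhds
      filter_upwards [hc.eventually (lt_mem_nhds (by simpa using h : (0:ℝ) < _))] with t ht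
      simpa using ht.le
    · filter_upwards with t
      simp [← h, hs e h.symm]
  obtain ⟨t, ht, ht0⟩ := ((Filter.eventually_all.2 hev).and self_mem_nhdsWithin).exists
  refine ⟨t, ht0, mem_flowPolytope.2 ⟨ht, ?_, a2.add ((a2.sub b2).smul t)⟩⟩
  simp [Finset.sum_add_distrib, ← Finset.mul_sum, a1, b1]

theorem convex_flowPolytope (G : MultiDigraph V E) : Convex ℝ G.flowPolytope := by
  intro φ hφ ψ hψ a b ha hb hab
  obtain ⟨a0, a1, a2⟩ := mem_flowPolytope.1 hφ
  obtain ⟨b0, b1, b2⟩ := mem_flowPolytope.1 hψ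
  refine mem_flowPolytope.2 ⟨fun e => add_nonneg (mul_nonneg ha (a0 e)) (mul_nonneg hb (b0 e)), ?_,
    (a2.smul a).add (b2.smul b)⟩
  simp [Finset.sum_add_distrib, ← Finset.mul_sum, a1, b1, hab]

/-- A nonempty convex set of nonnegative functions contains one whose support contains all the other
supports. -/
theorem exists_max_support {F : Set (E → ℝ)} (hF : Convex ℝ F) (hne : F.Nonempty)
    (h0 : ∀ φ ∈ F, ∀ e, 0 ≤ φ e) : ∃ φ ∈ F, ∀ ψ ∈ F, ∀ e, φ e = 0 → ψ e = 0 := by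
  classical
  obtain ⟨φ, hφ, hmax⟩ : ∃ φ ∈ F, ∀ ψ ∈ F, (Finset.univ.filter fun e => 0 < ψ e).card ≤
      (Finset.univ.filter fun e => 0 < φ e).card := by
    let S : Set ℕ := (fun φ : E → ℝ => (Finset.univ.filter fun e => 0 < φ e).card) '' F
    have hS : S.Finite := (Set.finite_Iic (Fintype.card E)).subset (by
      rintro _ ⟨φ, -, rfl⟩; exact Finset.card_le_univ _)
    obtain ⟨_, ⟨φ, hφ, rfl⟩, hm⟩ := hS.exists_maximal (hne.image _)
    refine ⟨φ, hφ, fun ψ hψ => ?_⟩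
    rcases le_total (Finset.univ.filter fun e => 0 < ψ e).card
      (Finset.univ.filter fun e => 0 < φ e).card with h | h
    · exact h
    · exact hm ⟨ψ, hψ, rfl⟩ h
  refine ⟨φ, hφ, fun ψ hψ e he => ?_⟩
  by_contra hne'
  -- The support of the midpoint is the union of the two supports.
  have hmid := hF hφ hψ (show (0:ℝ) ≤ 1/2 by norm_num) (show (0:ℝ) ≤ 1/2 by norm_num) (by norm_num)
  refine absurd (hmax _ hmid) (not_le.2 (Finset.card_lt_card ?_))
  rw [Finset.ssubset_iff_of_subset]
  · refine ⟨e, ?_, by simp [he]⟩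
    have := lt_of_le_of_ne (h0 ψ hψ e) (Ne.symm hne')
    simp [he, this]
  · intro b hb
    have hb' : 0 < φ b := by simpa using hb
    have := h0 ψ hψ b
    have : 0 < 1/2 * φ b + 1/2 * ψ b := by linarith
    simpa using this

/-- `H` is the support of a point `φ` of the face with largest support. A flow `ψ` supported on `H`
is in the face: the polytope contains a point beyond `φ` on the ray from `ψ`, so the functional,
which is maximal at `φ`, cannot be smaller at `ψ`. -/
theorem exists_face_of_isExposed [Fintype V] {F : Set (E → ℝ)}
    (hF : IsExposed ℝ G.flowPolytope F) :
    ∃ H : G.Subgraph, H.IsFaceSubgraph ∧ F = H.face := by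
  rcases F.eq_empty_or_nonempty with rfl | hne
  · have hflow : G.IsFlow (0 : E → ℝ) := by intro v; simp
    refine ⟨G.supportSubgraph 0, hflow.isFaceSubgraph (by simp), ?_⟩
    symm
    rw [Set.eq_empty_iff_forall_notMem]
    intro φ hφ
    obtain ⟨e, he⟩ := Subgraph.face_edges_nonempty hφ
    exact absurd he (by simp [supportSubgraph])
  · obtain ⟨L, rfl⟩ := hF hne
    have hconv : Convex ℝ {x ∈ G.flowPolytope | ∀ y ∈ G.flowPolytope, L y ≤ L x} :=
      hF.convex G.convex_flowPolytope
    obtain ⟨φ, hφ, hmax⟩ := exists_max_support hconv hne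
      (fun φ hφ => (mem_flowPolytope.1 hφ.1).1)
    obtain ⟨a0, a1, a2⟩ := mem_flowPolytope.1 hφ.1
    refine ⟨G.supportSubgraph φ, a2.isFaceSubgraph a0, Set.ext fun ψ => ⟨fun hψ => ⟨hψ.1, ?_⟩,
      fun hψ => ⟨hψ.1, ?_⟩⟩⟩
    · intro e he
      exact hmax ψ hψ e (le_antisymm (not_lt.1 he) (a0 e))
    · obtain ⟨t, ht, hmem⟩ := exists_extend_mem_flowPolytope hφ.1 hψ.1
        (fun e he => hψ.2 e (by simp [supportSubgraph, he]))
      have h1 := hφ.2 _ hmem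
      have h2 : L φ ≤ L ψ := by
        simp only [map_add, map_smul, map_sub, smul_eq_mul] at h1
        have : t * (L φ - L ψ) ≤ 0 := by linarith
        nlinarith [nonpos_of_mul_nonpos_right this ht]
      exact fun y hy => (hφ.2 y hy).trans h2

theorem Subgraph.IsFaceSubgraph.face_injective {H K : G.Subgraph} (hH : H.IsFaceSubgraph)
    (hK : K.IsFaceSubgraph) (h : H.face = K.face) : H = K := by
  have key : ∀ {H K : G.Subgraph}, H.IsFaceSubgraph → H.face = K.face → H.edges ⊆ K.edges := by
    intro H K hH h e he
    obtain ⟨φ, hφ, hp⟩ := hH.exists_pos ⟨e, he⟩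
    by_contra hn
    rw [h] at hφ
    exact (hp e he).ne' (hφ.2 e hn)
  exact hH.ext_edges hK ((key hH h).antisymm (key hK h.symm))

/-- The equations defining the face persist on its affine span, so there positivity on the edges of
`H` is an open condition that implies membership. Conversely, if an interior point vanished at an
edge of `H`, moving slightly away from a flow positive there would make that coordinate negative. -/
theorem Subgraph.IsFaceSubgraph.intrinsicInterior_face {H : G.Subgraph} (hH : H.IsFaceSubgraph) :
    intrinsicInterior ℝ H.face = {φ | φ ∈ H.face ∧ ∀ e ∈ H.edges, 0 < φ e} := by
  ext φ
  constructor
  · intro hφ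
    have hmem := intrinsicInterior_subset hφ
    refine ⟨hmem, fun e he => ?_⟩
    obtain ⟨φ₀, hφ₀, hp⟩ := hH.exists_pos ⟨e, he⟩
    obtain ⟨y, hy, hyφ⟩ := mem_intrinsicInterior.1 hφ
    have hline : ∀ t : ℝ, φ + t • (φ - φ₀) ∈ affineSpan ℝ H.face := by
      intro t
      have := AffineMap.lineMap_mem (1 + t) (subset_affineSpan ℝ _ hφ₀) (subset_affineSpan ℝ _ hmem)
      convert this using 1
      simp only [AffineMap.lineMap_apply, vsub_eq_sub, vadd_eq_add]
      module
    let c : ℝ → affineSpan ℝ H.face := fun t => ⟨_, hline t⟩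
    have hc : Continuous c := by
      apply Continuous.subtype_mk; fun_prop
    have hc0 : c 0 = y := by
      apply Subtype.ext; simp [c, hyφ]
    have hev : ∀ᶠ t in nhdsWithin (0 : ℝ) (Set.Ioi 0), c t ∈ interior ((↑) ⁻¹' H.face) := by
      have : c ⁻¹' (interior ((↑) ⁻¹' H.face)) ∈ nhds (0 : ℝ) :=
        (isOpen_interior.preimage hc).mem_nhds (by rw [Set.mem_preimage, hc0]; exact hy)
      exact nhdsWithin_le_nhds this
    obtain ⟨t, ht, ht0⟩ := (hev.and self_mem_nhdsWithin).exists
    have h1 : φ + t • (φ - φ₀) ∈ H.face := interior_subset (s := Subtype.val ⁻¹' H.face) ht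
    have h2 := (mem_flowPolytope.1 h1.1).1 e
    have h3 := (mem_flowPolytope.1 hmem.1).1 e
    simp only [Pi.add_apply, Pi.smul_apply, Pi.sub_apply, smul_eq_mul] at h2
    have ht0' : 0 < t := ht0
    by_contra hn
    have : φ e = 0 := le_antisymm (not_lt.1 hn) h3
    rw [this] at h2
    nlinarith [mul_pos ht0' (hp e he)]
  · rintro ⟨hmem, hp⟩
    refine mem_intrinsicInterior.2 ⟨⟨φ, subset_affineSpan ℝ _ hmem⟩, ?_, rfl⟩
    rw [mem_interior]
    refine ⟨Subtype.val ⁻¹' {ψ : E → ℝ | ∀ e ∈ H.edges, 0 < ψ e}, ?_, ?_, hp⟩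
    · rintro ⟨ψ, hψ⟩ hpos
      have haff : ∀ ψ ∈ affineSpan ℝ H.face,
          ∑ e, ψ e = 1 ∧ G.IsFlow ψ ∧ ∀ e, e ∉ H.edges → ψ e = 0 := by
        intro ψ hψ
        refine affineSpan_induction hψ (fun x hx =>
          ⟨(mem_flowPolytope.1 hx.1).2.1, (mem_flowPolytope.1 hx.1).2.2, hx.2⟩) ?_
        · intro c u v w hu hv hw
          refine ⟨?_, ((hu.2.1.sub hv.2.1).smul c).add hw.2.1, fun e he => ?_⟩
          · simp [Finset.sum_add_distrib, ← Finset.mul_sum, hu.1, hv.1, hw.1]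
          · simp [hu.2.2 e he, hv.2.2 e he, hw.2.2 e he]
      obtain ⟨h1, h2, h3⟩ := haff ψ hψ
      refine ⟨mem_flowPolytope.2 ⟨fun e => ?_, h1, h2⟩, h3⟩
      by_cases he : e ∈ H.edges
      · exact (hpos e he).le
      · exact (h3 e he).ge
    · refine IsOpen.preimage continuous_subtype_val ?_
      simp only [Set.ofPred_forall]
      exact isOpen_iInter_of_finite fun e => isOpen_iInter_of_finite fun _ =>
        isOpen_lt continuous_const (continuous_apply e)

theorem isClosed_flowPolytope (G : MultiDigraph V E) : IsClosed G.flowPolytope := by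
  have : G.flowPolytope = stdSimplex ℝ E ∩
      ⋂ v : V, {φ | ∑ e with G.head e = v, φ e = ∑ e with G.tail e = v, φ e} := by
    ext; simp [flowPolytope]
  rw [this]
  refine (isClosed_stdSimplex ℝ E).inter ?_
  exact isClosed_iInter fun v => isClosed_eq
    (continuous_finsetSum _ fun e _ => continuous_apply e)
    (continuous_finsetSum _ fun e _ => continuous_apply e)

/-- If `G` carries a positive flow, then every flow is a limit of positive flows. -/
theorem subset_closure_pos {φ₀ : E → ℝ} (h₀ : φ₀ ∈ G.flowPolytope) (hp : ∀ e, 0 < φ₀ e) :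
    G.flowPolytope ⊆ closure {φ | φ ∈ G.flowPolytope ∧ ∀ e, 0 < φ e} := by
  intro φ hφ
  have hc : Filter.Tendsto (fun t : ℝ => (1 - t) • φ + t • φ₀) (nhdsWithin 0 (Set.Ioi 0))
      (nhds ((1 - (0:ℝ)) • φ + (0:ℝ) • φ₀)) :=
    (Continuous.tendsto (by fun_prop) 0).mono_left nhdsWithin_le_nhds
  simp only [sub_zero, one_smul, zero_smul, add_zero] at hc
  refine mem_closure_of_tendsto hc ?_
  filter_upwards [self_mem_nhdsWithin, nhdsWithin_le_nhds (Iio_mem_nhds (zero_lt_one' ℝ))]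
    with t ht0 ht1
  have ht0' : 0 < t := ht0
  have ht1' : t < 1 := ht1
  refine ⟨G.convex_flowPolytope hφ h₀ (by linarith) ht0'.le (by ring), fun e => ?_⟩
  exact add_pos_of_nonneg_of_pos (mul_nonneg (by linarith) ((mem_flowPolytope.1 hφ).1 e))
    (mul_pos ht0' (hp e))

end MultiDigraph

end OrderPatterns

namespace OrderPatterns

open MultiDigraph Relation

/-! ### Order patterns and permutations -/

/-- `τ ∘ σ⁻¹` is an order automorphism of `Fin n`, and only the identity is one. -/
theorem perm_ext_of_lt_iff {n : ℕ} {σ τ : Perm (Fin n)} (h : ∀ i j, σ i < σ j ↔ τ i < τ j) :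
    σ = τ := by
  let e : Fin n ≃o Fin n :=
    { toEquiv := σ.symm.trans τ
      map_rel_iff' := by
        intro a b
        have := h (σ.symm b) (σ.symm a)
        simp only [Equiv.apply_symm_apply] at this
        simpa using (not_congr this).symm }
  have he : e = OrderIso.refl _ := Subsingleton.elim _ _
  ext i
  have := congrArg (fun f : Fin n ≃o Fin n => f (σ i)) he
  simp only [e, RelIso.coe_fn_mk, Equiv.trans_apply, Equiv.symm_apply_apply,
    OrderIso.refl_apply] at this
  rw [this]

theorem orderPattern_eq_iff {n : ℕ} {α : Type*} [LinearOrder α] {y : Fin n → α}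
    (hy : Function.Injective y) {σ : Perm (Fin n)} :
    orderPattern y = σ ↔ ∀ i j, y i < y j ↔ σ i < σ j := by
  constructor
  · rintro rfl i j; exact (orderPattern_lt_iff y hy i j).symm
  · intro h
    exact perm_ext_of_lt_iff fun i j => (orderPattern_lt_iff y hy i j).trans (h i j)

theorem rho_lt_iff {n : ℕ} (σ : Perm (Fin (n + 1))) (i j : Fin n) :
    rho σ i < rho σ j ↔ σ i.castSucc < σ j.castSucc :=
  orderPattern_lt_iff _ (σ.injective.comp (Fin.castSucc_injective n)) i j

theorem rho'_lt_iff {n : ℕ} (σ : Perm (Fin (n + 1))) (i j : Fin n) :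
    rho' σ i < rho' σ j ↔ σ i.succ < σ j.succ :=
  orderPattern_lt_iff _ (σ.injective.comp (Fin.succ_injective n)) i j

theorem rho_orderPattern {n : ℕ} {α : Type*} [LinearOrder α] {y : Fin (n + 1) → α}
    (hy : Function.Injective y) :
    rho (orderPattern y) = orderPattern fun i : Fin n => y i.castSucc := by
  symm
  rw [orderPattern_eq_iff (y := fun i : Fin n => y i.castSucc)
    (hy.comp (Fin.castSucc_injective n))]
  intro i j
  rw [rho_lt_iff, orderPattern_lt_iff y hy]

theorem rho'_orderPattern {n : ℕ} {α : Type*} [LinearOrder α] {y : Fin (n + 1) → α}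
    (hy : Function.Injective y) :
    rho' (orderPattern y) = orderPattern fun i : Fin n => y i.succ := by
  symm
  rw [orderPattern_eq_iff (y := fun i : Fin n => y i.succ) (hy.comp (Fin.succ_injective n))]
  intro i j
  rw [rho'_lt_iff, orderPattern_lt_iff y hy]

/-- The path in the permutation digraph traced by a sequence of distinct elements. -/
def seqPath (m : ℕ) {α : Type*} [LinearOrder α] (x : ℕ → α) (hx : Function.Injective x) (n : ℕ) :
    (permDigraph m).Path :=
  Path.ofSeq (fun k => orderPattern fun i : Fin m => x (k + i))
    (fun k => orderPattern fun i : Fin (m + 1) => x (k + i)) n (by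
      intro k _
      have h : Function.Injective fun i : Fin (m + 1) => x (k + i) := fun a b hab =>
        Fin.ext (by simpa using hx hab)
      refine ⟨rho_orderPattern h, (rho'_orderPattern h).trans ?_⟩
      congr 1; ext i
      simp [add_assoc, add_comm 1])

/-- Each generating relation is read off a window of the sequence itself. This turns drift into
inequalities between orbit points, and lets a single sequence refute a drift. -/
theorem PosetLE.le_of_seqPath {m : ℕ} {α : Type*} [LinearOrder α] {x : ℕ → α}
    {hx : Function.Injective x} {n i j : ℕ} (h : PosetLE (seqPath m x hx n) i j) : x i ≤ x j := by
  induction h with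
  | refl => exact le_rfl
  | tail _ hs ih =>
    refine ih.trans ?_
    cases hs with
    | vert k c d h =>
      refine not_lt.1 fun hlt => absurd h (not_le.2 ?_)
      exact (orderPattern_lt_iff (fun i : Fin m => x (k + i))
        (fun a b hab => Fin.ext (by simpa using hx hab)) _ _).2 hlt
    | edge k c d h =>
      refine not_lt.1 fun hlt => absurd h (not_le.2 ?_)
      exact (orderPattern_lt_iff (fun i : Fin (m + 1) => x (k + i))
        (fun a b hab => Fin.ext (by simpa using hx hab)) _ _).2 hlt

/-! ### The order generated by a list of patterns -/

variable {m : ℕ}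

/-- The strict comparisons between the entries of the successive patterns in a list. -/
def WindowLT (l : List (Perm (Fin (m + 1)))) (i j : ℕ) : Prop :=
  ∃ (k : ℕ) (hk : k < l.length) (c d : Fin (m + 1)), l[k] c < l[k] d ∧ i = k + c ∧ j = k + d

/-- The reflexive transitive closure of `WindowLT`. -/
def Precedes (l : List (Perm (Fin (m + 1)))) : ℕ → ℕ → Prop := ReflTransGen (WindowLT l)

theorem WindowLT.lt_length_add {l : List (Perm (Fin (m + 1)))} {i j : ℕ} (h : WindowLT l i j) :
    i < l.length + m ∧ j < l.length + m := by
  obtain ⟨k, hk, c, d, -, rfl, rfl⟩ := h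
  omega

theorem windowLT_append {l₁ l₂ : List (Perm (Fin (m + 1)))} {i j : ℕ}
    (h : WindowLT (l₁ ++ l₂) i j) :
    WindowLT l₁ i j ∨ ∃ a b, i = l₁.length + a ∧ j = l₁.length + b ∧ WindowLT l₂ a b := by
  obtain ⟨k, hk, c, d, h, rfl, rfl⟩ := h
  rcases lt_or_ge k l₁.length with hlt | hge
  · left
    rw [List.getElem_append_left hlt] at h
    exact ⟨k, hlt, c, d, h, rfl, rfl⟩
  · right
    rw [List.getElem_append_right hge] at h
    refine ⟨k - l₁.length + c, k - l₁.length + d, by omega, by omega,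
      k - l₁.length, by simp at hk; omega, c, d, h, rfl, rfl⟩

/-- Every walk in the permutation digraph is realized by a sequence of rationals. -/
theorem MultiDigraph.IsWalk.exists_realization {u w : Perm (Fin m)}
    {l : List (Perm (Fin (m + 1)))} (h : (permDigraph m).IsWalk u l w) :
    ∃ x : ℕ → ℚ, (∀ i j, WindowLT l i j → x i < x j) ∧ (∀ c d, u c < u d → x c < x d) ∧
      ∀ c d, w c < w d → x (l.length + c) < x (l.length + d) := by
  induction l generalizing u with
  | nil =>
    cases h
    have key : ∀ c d, w c < w d → (fun i => if h : i < m then ((w ⟨i, h⟩ : ℕ) : ℚ) else 0) (c : ℕ) <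
        (fun i => if h : i < m then ((w ⟨i, h⟩ : ℕ) : ℚ) else 0) (d : ℕ) := by
      intro c d hcd; simpa using hcd
    refine ⟨fun i => if h : i < m then ((w ⟨i, h⟩ : ℕ) : ℚ) else 0, ?_, key, by simp⟩
    rintro i j ⟨k, hk, -⟩
    simp at hk
  | cons e l ih =>
    obtain ⟨x, hx, h0, h1⟩ := ih h.2
    have h0' : ∀ c d : Fin m, e c.succ < e d.succ → x c < x d := fun c d hcd =>
      h0 c d ((rho'_lt_iff e c d).2 hcd)
    -- The realization grows from the back. The new first entry shares a window only with the next
    -- `m` entries, already ordered as the edge demands, so density of the rationals gives it a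
    -- value.
    obtain ⟨q, hlo, hhi⟩ := Order.exists_between_finsets
      ((Finset.univ.filter fun c : Fin m => e c.succ < e 0).image fun c : Fin m => x c)
      ((Finset.univ.filter fun c : Fin m => e 0 < e c.succ).image fun c : Fin m => x c) (by
        intro a ha b hb
        simp only [Finset.mem_image, Finset.mem_filter, Finset.mem_univ, true_and] at ha hb
        obtain ⟨c, hc, rfl⟩ := ha
        obtain ⟨d, hd, rfl⟩ := hb
        exact h0' c d (hc.trans hd))
    simp only [Finset.mem_image, Finset.mem_filter, Finset.mem_univ, true_and,
      forall_exists_index, and_imp, forall_apply_eq_imp_iff₂] at hlo hhi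
    let z : ℕ → ℚ := fun n => Nat.casesOn n q x
    have hz : ∀ c d : Fin (m + 1), e c < e d → z c < z d := by
      intro c d
      induction c using Fin.cases with
      | zero =>
        induction d using Fin.cases with
        | zero => exact fun h => absurd h (lt_irrefl _)
        | succ d => exact fun h => hhi d h
      | succ c =>
        induction d using Fin.cases with
        | zero => exact fun h => hlo c h
        | succ d => exact fun h => h0' c d h
    refine ⟨z, ?_, ?_, ?_⟩
    · rintro i j ⟨k, hk, c, d, hcd, rfl, rfl⟩
      cases k with
      | zero => simpa using hz c d (by simpa using hcd)
      | succ k =>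
        have := hx (k + c) (k + d) ⟨k, by simpa using hk, c, d, by simpa using hcd, rfl, rfl⟩
        have e1 : k + 1 + (c : ℕ) = (k + c) + 1 := by omega
        have e2 : k + 1 + (d : ℕ) = (k + d) + 1 := by omega
        rw [e1, e2]
        exact this
    · intro c d hcd
      have h2 : rho e = u := h.1
      rw [← h2, rho_lt_iff] at hcd
      simpa using hz _ _ hcd
    · intro c d hcd
      have := h1 c d hcd
      have e1 : (e :: l).length + (c : ℕ) = (l.length + c) + 1 := by simp; omega
      have e2 : (e :: l).length + (d : ℕ) = (l.length + d) + 1 := by simp; omega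
      rw [e1, e2]
      exact this

theorem Precedes.le_of_windowLT {l : List (Perm (Fin (m + 1)))} {x : ℕ → ℚ}
    (hx : ∀ i j, WindowLT l i j → x i < x j) {i j : ℕ} (h : Precedes l i j) : x i ≤ x j := by
  induction h with
  | refl => exact le_rfl
  | tail _ hs ih => exact ih.trans (hx _ _ hs).le

theorem lt_of_transGen_windowLT {l : List (Perm (Fin (m + 1)))} {x : ℕ → ℚ}
    (hx : ∀ i j, WindowLT l i j → x i < x j) {i j : ℕ} (h : TransGen (WindowLT l) i j) :
    x i < x j := by
  induction h with
  | single hs => exact hx _ _ hs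
  | tail _ hs ih => exact ih.trans (hx _ _ hs)

theorem Precedes.antisymm {u w : Perm (Fin m)} {l : List (Perm (Fin (m + 1)))}
    (h : (permDigraph m).IsWalk u l w) {i j : ℕ} (hij : Precedes l i j) (hji : Precedes l j i) :
    i = j := by
  obtain ⟨x, hx, -⟩ := h.exists_realization
  rcases reflTransGen_iff_eq_or_transGen.1 hij with h1 | h1
  · exact h1.symm
  · exact absurd (lt_of_transGen_windowLT hx h1) (not_lt.2 (hji.le_of_windowLT hx))

/-- A realization of the walk orders the last window as `w` does, so no chain through earlier
windows can contradict `w`. -/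
theorem Precedes.le_last {u w : Perm (Fin m)} {l : List (Perm (Fin (m + 1)))}
    (h : (permDigraph m).IsWalk u l w) {a b : Fin m}
    (hab : Precedes l (l.length + a) (l.length + b)) : w a ≤ w b := by
  obtain ⟨x, hx, -, h1⟩ := h.exists_realization
  by_contra hn
  exact absurd (h1 _ _ (not_le.1 hn)) (not_lt.2 (hab.le_of_windowLT hx))

theorem Precedes.le_first {u w : Perm (Fin m)} {l : List (Perm (Fin (m + 1)))}
    (h : (permDigraph m).IsWalk u l w) {a b : Fin m} (hab : Precedes l a b) : u a ≤ u b := by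
  obtain ⟨x, hx, h0, -⟩ := h.exists_realization
  by_contra hn
  exact absurd (h0 _ _ (not_le.1 hn)) (not_lt.2 (hab.le_of_windowLT hx))

theorem precedes_first {u w : Perm (Fin m)} {l : List (Perm (Fin (m + 1)))}
    (h : (permDigraph m).IsWalk u l w) (hl : l ≠ []) {a b : Fin m} (hab : u a ≤ u b) :
    Precedes l a b := by
  rcases hab.lt_or_eq with hlt | heq
  · cases l with
    | nil => exact absurd rfl hl
    | cons e l =>
      have h2 : rho e = u := h.1
      rw [← h2, rho_lt_iff] at hlt
      exact .single ⟨0, by simp, a.castSucc, b.castSucc, hlt, by simp, by simp⟩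
  · rw [u.injective heq]; exact .refl

theorem precedes_last {u w : Perm (Fin m)} {l : List (Perm (Fin (m + 1)))}
    (h : (permDigraph m).IsWalk u l w) (hl : l ≠ []) {a b : Fin m} (hab : w a ≤ w b) :
    Precedes l (l.length + a) (l.length + b) := by
  rcases hab.lt_or_eq with hlt | heq
  · have hpos := List.length_pos_iff.2 hl
    have h2 : rho' (l[l.length - 1]'(by omega)) = w :=
      h.tail_getElem_last (l.length - 1) (by omega)
    rw [← h2, rho'_lt_iff] at hlt
    exact .single ⟨l.length - 1, by omega, a.succ, b.succ, hlt, by simp; omega, by simp; omega⟩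
  · rw [w.injective heq]; exact .refl

/-- A chain that crosses from the left part to the right part of two glued relations passes through
the overlap. -/
theorem reflTransGen_glue {S S₁ S₂ : ℕ → ℕ → Prop} {t m : ℕ}
    (hS : ∀ i j, S i j → S₁ i j ∨ ∃ a b, i = t + a ∧ j = t + b ∧ S₂ a b)
    (h₁ : ∀ i j, S₁ i j → i < t + m ∧ j < t + m)
    (hc : ∀ a b, a < m → b < m → ReflTransGen S₁ (t + a) (t + b) → ReflTransGen S₂ a b)
    {i j : ℕ} (h : ReflTransGen S i (t + j)) :
    (i < t + m → ∃ k < m, ReflTransGen S₁ i (t + k) ∧ ReflTransGen S₂ k j) ∧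
      ∀ a, i = t + a → ReflTransGen S₂ a j := by
  -- The second claim covers a chain that starts in the right part and dips into the left one: it
  -- comes back through the overlap, where `hc` replaces the excursion by a relation of the right
  -- part.
  induction h using ReflTransGen.head_induction_on with
  | refl =>
    refine ⟨fun hj => ⟨j, by omega, .refl, .refl⟩, fun a ha => ?_⟩
    rw [show a = j by omega]
  | head hs _ ih =>
    rcases hS _ _ hs with hs | ⟨a, b, rfl, rfl, hs₂⟩
    · obtain ⟨k, hk, hk1, hk2⟩ := ih.1 (h₁ _ _ hs).2
      refine ⟨fun _ => ⟨k, hk, .head hs hk1, hk2⟩, ?_⟩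
      rintro a rfl
      have := (h₁ _ _ hs).1
      exact (hc a k (by omega) hk (.head hs hk1)).trans hk2
    · have : ReflTransGen S₂ a j := .head hs₂ (ih.2 b rfl)
      refine ⟨fun ha => ⟨a, by omega, .refl, this⟩, fun a' ha' => ?_⟩
      rwa [show a' = a by omega]

section Append

variable {u v w : Perm (Fin m)} {l₁ l₂ : List (Perm (Fin (m + 1)))}

/-- The two posets overlap in the window of `v` and induce the same total order on it, so a chain
from left to right can be cut at an entry of that window. -/
theorem Precedes.of_append (h₁ : (permDigraph m).IsWalk u l₁ v) (h₂ : (permDigraph m).IsWalk v l₂ w)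
    (hl : l₂ ≠ []) {i j : ℕ} (hi : i < l₁.length + m)
    (h : Precedes (l₁ ++ l₂) i (l₁.length + j)) :
    ∃ k : Fin m, Precedes l₁ i (l₁.length + k) ∧ Precedes l₂ k j := by
  obtain ⟨k, hk, hk'⟩ := (reflTransGen_glue (S₁ := WindowLT l₁) (S₂ := WindowLT l₂)
    (fun _ _ => windowLT_append) (fun _ _ => WindowLT.lt_length_add) (fun a b ha hb hab =>
      precedes_first h₂ hl (a := ⟨a, ha⟩) (b := ⟨b, hb⟩) (Precedes.le_last h₁ hab)) h).1 hi
  exact ⟨⟨k, hk⟩, hk'⟩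

theorem Precedes.of_append_swap (h₁ : (permDigraph m).IsWalk u l₁ v)
    (h₂ : (permDigraph m).IsWalk v l₂ w) (hl : l₂ ≠ []) {i j : ℕ} (hi : i < l₁.length + m)
    (h : Precedes (l₁ ++ l₂) (l₁.length + j) i) :
    ∃ k : Fin m, Precedes l₁ (l₁.length + k) i ∧ Precedes l₂ j k := by
  obtain ⟨k, hk, hk1, hk2⟩ := (reflTransGen_glue (S := Function.swap (WindowLT (l₁ ++ l₂)))
    (S₁ := Function.swap (WindowLT l₁)) (S₂ := Function.swap (WindowLT l₂))
    (fun i j hij => (windowLT_append hij).imp id fun ⟨a, b, ha, hb, hab⟩ => ⟨b, a, hb, ha, hab⟩)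
    (fun _ _ hij => hij.lt_length_add.symm) (fun a b ha hb hab =>
      (precedes_first h₂ hl (a := ⟨b, hb⟩) (b := ⟨a, ha⟩)
        (Precedes.le_last h₁ hab.swap)).swap) h.swap).1 hi
  exact ⟨⟨k, hk⟩, hk1.swap, hk2.swap⟩

end Append

/-! ### Separating loops -/

/-- The first and the last window of the walk `l` are incomparable. -/
def IsSeparating (l : List (Perm (Fin (m + 1)))) : Prop :=
  ∀ a b : Fin m, ¬ Precedes l a (l.length + b) ∧ ¬ Precedes l (l.length + b) a

/-- `up` makes the `r` lowest entries of the last window lie above nothing in the first window, by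
induction on `r`; `down` makes the `r` highest entries lie below nothing in it. Each step appends a
loop that violates one drift. -/
theorem exists_isSeparating {v : Perm (Fin m)} {P : Perm (Fin (m + 1)) → Prop}
    (h0 : ∃ l, (permDigraph m).IsWalk v l v ∧ l ≠ [] ∧ ∀ e ∈ l, P e)
    (h1 : ∀ j : Fin m, ∃ l, (permDigraph m).IsWalk v l v ∧ l ≠ [] ∧ (∀ e ∈ l, P e) ∧
      ¬ Precedes l j (l.length + j))
    (h2 : ∀ j : Fin m, ∃ l, (permDigraph m).IsWalk v l v ∧ l ≠ [] ∧ (∀ e ∈ l, P e) ∧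
      ¬ Precedes l (l.length + j) j) :
    ∃ l, (permDigraph m).IsWalk v l v ∧ l ≠ [] ∧ (∀ e ∈ l, P e) ∧ IsSeparating l := by
  have up : ∀ r ≤ m, ∃ l, (permDigraph m).IsWalk v l v ∧ l ≠ [] ∧ (∀ e ∈ l, P e) ∧
      ∀ j, (v j : ℕ) < r → ∀ i : Fin m, ¬ Precedes l i (l.length + j) := by
    intro r
    induction r with
    | zero =>
      intro _
      obtain ⟨l, hl, hl0, hlP⟩ := h0
      exact ⟨l, hl, hl0, hlP, by simp⟩
    | succ r ih =>
      intro hr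
      obtain ⟨l, hl, hl0, hlP, hlr⟩ := ih (by omega)
      obtain ⟨α, hα, hα0, hαP, hαj⟩ := h1 (v.symm ⟨r, hr⟩)
      refine ⟨l ++ α, hl.append hα, by simp [hl0], ?_, ?_⟩
      · intro e he
        exact (List.mem_append.1 he).elim (hlP e) (hαP e)
      · intro j hj i hp
        rw [List.length_append, add_assoc] at hp
        obtain ⟨k, hk1, hk2⟩ := Precedes.of_append hl hα hα0 (by omega) hp
        -- The chain crosses the middle window at an entry of rank at least `r`, by induction. With
        -- the order inside the end windows of `α`, this would put the entry of rank `r` below its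
        -- own copy.
        have hk : r ≤ (v k : ℕ) := by
          by_contra hn
          exact hlr k (by omega) i hk1
        refine hαj ((precedes_first hα hα0 ?_).trans (hk2.trans (precedes_last hα hα0 ?_)))
        · rw [Equiv.apply_symm_apply]; exact hk
        · rw [Equiv.apply_symm_apply]; exact Nat.lt_succ_iff.1 hj
  have down : ∀ r ≤ m, ∃ l, (permDigraph m).IsWalk v l v ∧ l ≠ [] ∧ (∀ e ∈ l, P e) ∧
      ∀ j, m ≤ (v j : ℕ) + r → ∀ i : Fin m, ¬ Precedes l (l.length + j) i := by
    intro r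
    induction r with
    | zero =>
      intro _
      obtain ⟨l, hl, hl0, hlP⟩ := h0
      exact ⟨l, hl, hl0, hlP, by intro j hj; omega⟩
    | succ r ih =>
      intro hr
      obtain ⟨l, hl, hl0, hlP, hlr⟩ := ih (by omega)
      obtain ⟨α, hα, hα0, hαP, hαj⟩ := h2 (v.symm ⟨m - (r + 1), by omega⟩)
      refine ⟨l ++ α, hl.append hα, by simp [hl0], ?_, ?_⟩
      · intro e he
        exact (List.mem_append.1 he).elim (hlP e) (hαP e)
      · intro j hj i hp
        rw [List.length_append, add_assoc] at hp
        obtain ⟨k, hk1, hk2⟩ := Precedes.of_append_swap hl hα hα0 (by omega) hp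
        have hk : (v k : ℕ) + r < m := by
          by_contra hn
          exact hlr k (by omega) i hk1
        refine hαj (((precedes_last hα hα0 ?_).trans hk2).trans (precedes_first hα hα0 ?_))
        · rw [Equiv.apply_symm_apply, Fin.le_def]; simp only; omega
        · rw [Equiv.apply_symm_apply, Fin.le_def]; simp only; omega
  obtain ⟨l₁, hl₁, hl₁0, hl₁P, hl₁r⟩ := up m le_rfl
  obtain ⟨l₂, hl₂, hl₂0, hl₂P, hl₂r⟩ := down m le_rfl
  -- An upward comparison would have to cross `l₁`, a downward one `l₂`; both crossings are
  -- excluded.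
  refine ⟨l₁ ++ l₂, hl₁.append hl₂, by simp [hl₁0], ?_, fun a b => ⟨fun hp => ?_, fun hp => ?_⟩⟩
  · intro e he
    exact (List.mem_append.1 he).elim (hl₁P e) (hl₂P e)
  · rw [List.length_append, add_assoc] at hp
    obtain ⟨k, hk1, -⟩ := Precedes.of_append hl₁ hl₂ hl₂0 (by omega) hp
    exact hl₁r k (v k).2 a hk1
  · rw [List.length_append, add_assoc] at hp
    obtain ⟨k, -, hk2⟩ := Precedes.of_append_swap hl₁ hl₂ hl₂0 (by omega) hp
    exact hl₂r b (by omega) k hk2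

/-- On a shorter walk the two end windows share an entry, which is comparable with itself. -/
theorem IsSeparating.le_length {l : List (Perm (Fin (m + 1)))} (h : IsSeparating l) :
    m ≤ l.length := by
  by_contra hn
  exact (h ⟨l.length, by omega⟩ ⟨0, by omega⟩).1 .refl

/-! ### Closing up a walk -/

/-- A strictly monotone function on part of a finite strict order extends to all of it. -/
theorem exists_strictMono_extension {R : ℕ → ℕ → Prop} (htr : ∀ i j k, R i j → R j k → R i k)
    (hirr : ∀ i, ¬ R i i) (S : Finset ℕ) (f : ℕ → ℚ)
    (hf : ∀ i ∈ S, ∀ j ∈ S, R i j → f i < f j) (T : Finset ℕ) :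
    ∃ g : ℕ → ℚ, (∀ i ∈ S, g i = f i) ∧ ∀ i ∈ S ∪ T, ∀ j ∈ S ∪ T, R i j → g i < g j := by
  classical
  induction T using Finset.induction_on with
  | empty => exact ⟨f, fun _ _ => rfl, by simpa using hf⟩
  | insert a T _ ih =>
    obtain ⟨g, hg, hm⟩ := ih
    by_cases ha : a ∈ S ∪ T
    · refine ⟨g, hg, ?_⟩
      rwa [Finset.union_insert, Finset.insert_eq_of_mem ha]
    · obtain ⟨q, hlo, hhi⟩ := Order.exists_between_finsets
        (((S ∪ T).filter fun i => R i a).image g) (((S ∪ T).filter fun i => R a i).image g) (by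
          intro x hx y hy
          obtain ⟨i, hi, rfl⟩ := Finset.mem_image.1 hx
          obtain ⟨j, hj, rfl⟩ := Finset.mem_image.1 hy
          rw [Finset.mem_filter] at hi hj
          exact hm i hi.1 j hj.1 (htr _ _ _ hi.2 hj.2))
      have hne : ∀ i ∈ S ∪ T, i ≠ a := fun i hi h => ha (h ▸ hi)
      refine ⟨Function.update g a q, fun i hi => ?_, ?_⟩
      · rw [Function.update_of_ne (hne i (Finset.mem_union_left _ hi)), hg i hi]
      · rw [Finset.union_insert]
        intro i hi j hj hij
        rcases Finset.mem_insert.1 hi with rfl | hi' <;> rcases Finset.mem_insert.1 hj with rfl | hj'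
        · exact absurd hij (hirr _)
        · rw [Function.update_self, Function.update_of_ne (hne j hj')]
          exact hhi _ (Finset.mem_image_of_mem _ (Finset.mem_filter.2 ⟨hj', hij⟩))
        · rw [Function.update_self, Function.update_of_ne (hne i hi')]
          exact hlo _ (Finset.mem_image_of_mem _ (Finset.mem_filter.2 ⟨hi', hij⟩))
        · rw [Function.update_of_ne (hne i hi'), Function.update_of_ne (hne j hj')]
          exact hm i hi' j hj' hij

/-- The closed walk `l` is realized by a periodic sequence. -/
def IsCyclic (l : List (Perm (Fin (m + 1)))) : Prop :=
  ∃ x : ℕ → ℚ, ∀ (k : ℕ) (hk : k < l.length) (c d : Fin (m + 1)), l[k] c < l[k] d →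
    x ((k + c) % l.length) < x ((k + d) % l.length)

/-- First realize `g`. Then prescribe on the first window of `l` the values at the end of `g`, and
on the last window of `l` those at the start of `g`. Separation means that the poset of `l` imposes
nothing between the two windows, so the prescription is monotone and extends over `l`. -/
theorem IsSeparating.isCyclic_append {v : Perm (Fin m)} {l g : List (Perm (Fin (m + 1)))}
    (hl : (permDigraph m).IsWalk v l v) (hs : IsSeparating l)
    (hg : (permDigraph m).IsWalk v g v) : IsCyclic (l ++ g) := by
  obtain ⟨y, hy, hy0, hy1⟩ := hg.exists_realization
  obtain ⟨x, hx, -⟩ := hl.exists_realization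
  have hm := hs.le_length
  have hbridge : ∀ {i j}, TransGen (WindowLT l) i j → Precedes l i j := TransGen.to_reflTransGen
  obtain ⟨z, hz, hzm⟩ := exists_strictMono_extension (R := TransGen (WindowLT l))
    (fun _ _ _ => TransGen.trans) (fun i hi => lt_irrefl _ (lt_of_transGen_windowLT hx hi))
    (Finset.range m ∪ Finset.Ico l.length (l.length + m))
    (fun i => if i < m then y (g.length + i) else y (i - l.length)) (by
      have ne_of : ∀ {i j}, TransGen (WindowLT l) i j → i ≠ j := by
        rintro i j h rfl
        exact lt_irrefl _ (lt_of_transGen_windowLT hx h)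
      intro i hi j hj hij
      simp only [Finset.mem_union, Finset.mem_range, Finset.mem_Ico] at hi hj
      have hne := ne_of hij
      rcases lt_or_ge i m with hi' | hi' <;> rcases lt_or_ge j m with hj' | hj'
      · rw [if_pos hi', if_pos hj']
        refine hy1 ⟨i, hi'⟩ ⟨j, hj'⟩ (lt_of_le_of_ne (Precedes.le_first hl (hbridge hij)) ?_)
        exact fun h => hne (by simpa using v.injective h)
      · obtain ⟨b, rfl⟩ := Nat.exists_eq_add_of_le (hj.resolve_left (by omega)).1
        exact absurd (hbridge hij) (hs ⟨i, hi'⟩ ⟨b, by omega⟩).1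
      · obtain ⟨b, rfl⟩ := Nat.exists_eq_add_of_le (hi.resolve_left (by omega)).1
        exact absurd (hbridge hij) (hs ⟨j, hj'⟩ ⟨b, by omega⟩).2
      · obtain ⟨a, rfl⟩ := Nat.exists_eq_add_of_le (hi.resolve_left (by omega)).1
        obtain ⟨b, rfl⟩ := Nat.exists_eq_add_of_le (hj.resolve_left (by omega)).1
        rw [if_neg (by omega), if_neg (by omega), Nat.add_sub_cancel_left, Nat.add_sub_cancel_left]
        refine hy0 ⟨a, by omega⟩ ⟨b, by omega⟩ (lt_of_le_of_ne (Precedes.le_last hl (hbridge hij)) ?_)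
        exact fun h => hne (by simpa using v.injective h))
    (Finset.range (l.length + m))
  have hz0 : ∀ a < m, z a = y (g.length + a) := by
    intro a ha
    rw [hz a (by simp [ha]), if_pos ha]
  have hz1 : ∀ b < m, z (l.length + b) = y b := by
    intro b hb
    rw [hz _ (by simp [hb]), if_neg (by omega), Nat.add_sub_cancel_left]
  have hzw : ∀ i j, WindowLT l i j → z i < z j := by
    intro i j hij
    have := hij.lt_length_add
    exact hzm i (by simp; omega) j (by simp; omega) (.single hij)
  have hN : (l ++ g).length = l.length + g.length := List.length_append
  -- One period is `z` along `l` and then `y` along `g`. By the matching end windows, each of the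
  -- two agrees with the periodic sequence for `m` entries past its own stretch, hence on every
  -- window that crosses a seam.
  set X : ℕ → ℚ := fun i => if i < l.length then z i else y (i - l.length) with hX
  have hXy : ∀ i, i < g.length + m → X ((l.length + i) % (l.length + g.length)) = y i := by
    intro i hi
    rcases lt_or_ge i g.length with h | h
    · rw [Nat.mod_eq_of_lt (by omega), hX]
      simp
    · obtain ⟨a, rfl⟩ := Nat.exists_eq_add_of_le h
      rw [← add_assoc, Nat.add_mod_left, Nat.mod_eq_of_lt (by omega), hX]
      simp only
      rw [if_pos (by omega), hz0 a (by omega)]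
  have hXz : ∀ i, i < l.length + m → X (i % (l.length + g.length)) = z i := by
    intro i hi
    rcases lt_or_ge i l.length with h | h
    · rw [Nat.mod_eq_of_lt (by omega), hX]
      simp [h]
    · obtain ⟨b, rfl⟩ := Nat.exists_eq_add_of_le h
      rw [hXy b (by omega), hz1 b (by omega)]
  refine ⟨X, fun k hk c d hcd => ?_⟩
  rw [hN] at hk ⊢
  rcases windowLT_append (l₁ := l) (l₂ := g) ⟨k, by rwa [hN], c, d, hcd, rfl, rfl⟩ with
    h | ⟨a, b, ha, hb, h⟩
  · have := h.lt_length_add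
    rw [hXz _ this.1, hXz _ this.2]
    exact hzw _ _ h
  · have := h.lt_length_add
    rw [ha, hb, hXy _ this.1, hXy _ this.2]
    exact hy _ _ h

/-! ### Drift -/

theorem WindowLT.posetLE {p : (permDigraph m).Path} {i j : ℕ} (h : WindowLT p.edges i j) :
    PosetLE p i j := by
  obtain ⟨k, hk, c, d, h, rfl, rfl⟩ := h
  have hk' : k < p.length := by simpa [Path.edges] using hk
  exact .single (.edge ⟨k, hk'⟩ c d (by simpa [Path.edges] using h.le))

theorem Precedes.posetLE {p : (permDigraph m).Path} {i j : ℕ} (h : Precedes p.edges i j) :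
    PosetLE p i j := by
  induction h with
  | refl => exact .refl
  | tail _ hs ih => exact ih.trans hs.posetLE

/-- The order of a vertex window is part of the order of an adjacent edge window, and positive
length guarantees that every vertex has such an edge. -/
theorem PosetLE.precedes {p : (permDigraph m).Path} (hp : 0 < p.length) {i j : ℕ}
    (h : PosetLE p i j) : Precedes p.edges i j := by
  have hedge : ∀ (k : Fin p.length) (c d : Fin (m + 1)), p.edge k c ≤ p.edge k d →
      Precedes p.edges (k + c) (k + d) := by
    intro k c d h
    rcases h.lt_or_eq with h | h
    · exact .single ⟨k, by simp [Path.edges], c, d, by simpa [Path.edges] using h, rfl, rfl⟩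
    · rw [(p.edge k).injective h]; exact .refl
  induction h with
  | refl => exact .refl
  | tail _ hs ih =>
    refine ih.trans ?_
    cases hs with
    | edge k c d h => exact hedge k c d h
    | vert k c d h =>
      rcases Nat.lt_or_ge k p.length with hk | hk
      · have h1 : rho (p.edge ⟨k, hk⟩) = p.vert k := p.head_edge ⟨k, hk⟩
        rw [← h1, ← not_lt, rho_lt_iff, not_lt] at h
        exact hedge ⟨k, hk⟩ c.castSucc d.castSucc h
      -- The last vertex has no outgoing edge on the path, so its incoming edge is used, which
      -- starts one entry earlier.
      · have h1 : rho' (p.edge ⟨k - 1, by omega⟩) = p.vert k := by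
          refine (p.tail_edge ⟨k - 1, by omega⟩).trans (congrArg _ (Fin.ext ?_))
          simp; omega
        rw [← h1, ← not_lt, rho'_lt_iff, not_lt] at h
        have := hedge ⟨k - 1, by omega⟩ c.succ d.succ h
        simp only [Fin.val_succ] at this
        rwa [show (k : ℕ) - 1 + (c + 1) = k + c by omega,
          show (k : ℕ) - 1 + (d + 1) = k + d by omega] at this

/-- In a driftless face subgraph, there is a separating loop at every vertex. -/
theorem Driftless.exists_isSeparating {H : (permDigraph m).Subgraph} (hD : Driftless H)
    (hH : H.IsFaceSubgraph) {v : Perm (Fin m)} (hv : v ∈ H.verts) :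
    ∃ l, (permDigraph m).IsWalk v l v ∧ l ≠ [] ∧ (∀ e ∈ l, e ∈ H.edges) ∧ IsSeparating l := by
  have hno : ¬ ConnectedDrifts (H.component v) := fun h => hD ⟨v, hv, h⟩
  have hloop : ∀ (j : Fin m) (ε : SignType), ε ≠ 0 → ∃ γ : (permDigraph m).Path,
      γ.IsLoopAt v ∧ γ.IsIn (H.component v) ∧ 0 < γ.length ∧ drift γ j j ≠ ε := by
    intro j ε hε
    by_contra hcon
    push Not at hcon
    exact hno ⟨v, ⟨hv, .refl _⟩, j, ε, hε, hcon⟩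
  have hwalk : ∀ γ : (permDigraph m).Path, γ.IsLoopAt v → γ.IsIn (H.component v) → 0 < γ.length →
      (permDigraph m).IsWalk v γ.edges v ∧ γ.edges ≠ [] ∧ ∀ e ∈ γ.edges, e ∈ H.edges := by
    intro γ h1 h2 h3
    refine ⟨?_, ?_, fun e he => ?_⟩
    · have := γ.isWalk_edges
      rwa [h1.1, h1.2] at this
    · rw [← List.length_pos_iff]; simpa [Path.edges] using h3
    · obtain ⟨i, rfl⟩ : ∃ i, γ.edge i = e := by simpa [Path.edges] using he
      exact (h2.2 i).1
  refine OrderPatterns.exists_isSeparating ?_ (fun j => ?_) (fun j => ?_)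
  · obtain ⟨e, he, hev⟩ := hH.1 v hv
    obtain ⟨φ, hφ, hpos⟩ := hH.exists_pos ⟨e, he⟩
    obtain ⟨h0, -, h1⟩ := mem_flowPolytope.1 hφ.1
    obtain ⟨l, hl, hlp⟩ := h1.exists_walk h0 (hpos e he)
    have hlH : ∀ e' ∈ l, e' ∈ H.edges := by
      intro e' he'
      by_contra hn
      exact (hlp e' he').ne' (hφ.2 e' hn)
    rcases hev with rfl | rfl
    · refine ⟨e :: l, ⟨rfl, hl⟩, by simp, ?_⟩
      intro a ha
      rcases List.mem_cons.1 ha with rfl | ha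
      exacts [he, hlH a ha]
    · refine ⟨l ++ [e], hl.append ⟨rfl, rfl⟩, by simp, ?_⟩
      intro a ha
      rcases List.mem_append.1 ha with ha | ha
      exacts [hlH a ha, by rw [List.mem_singleton.1 ha]; exact he]
  · obtain ⟨γ, h1, h2, h3, h4⟩ := hloop j 1 (by decide)
    obtain ⟨w1, w2, w3⟩ := hwalk γ h1 h2 h3
    refine ⟨γ.edges, w1, w2, w3, fun hp => h4 ?_⟩
    have := hp.posetLE
    rw [drift, if_pos (by simpa [Path.edges] using this)]
  · obtain ⟨γ, h1, h2, h3, h4⟩ := hloop j (-1) (by decide)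
    obtain ⟨w1, w2, w3⟩ := hwalk γ h1 h2 h3
    refine ⟨γ.edges, w1, w2, w3, fun hp => h4 ?_⟩
    have hlen : γ.edges.length = γ.length := by simp [Path.edges]
    rw [hlen] at hp
    rw [drift, if_neg, if_pos hp.posetLE]
    -- `drift` tests the sign + first. If both comparisons held, antisymmetry would identify two
    -- entries that are `γ.length > 0` apart.
    intro hq
    have := Precedes.antisymm w1 hp (hq.precedes h3)
    omega

/-- The whole permutation digraph, as a subgraph. -/
def fullSubgraph (m : ℕ) : (permDigraph m).Subgraph where
  verts := Set.univ
  edges := Set.univ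
  head_mem _ _ := trivial
  tail_mem _ _ := trivial

theorem drift_seqPath_ne {α : Type*} [LinearOrder α] {x : ℕ → α} (hx : Function.Injective x)
    (n : ℕ) (j : Fin m) :
    (x (n + j) < x j → drift (seqPath m x hx n) j j ≠ 1) ∧
      (x j < x (n + j) → drift (seqPath m x hx n) j j ≠ -1) := by
  have hlen : (seqPath m x hx n).length = n := rfl
  constructor
  · intro h
    have : ¬ PosetLE (seqPath m x hx n) j (n + j) := fun hp => absurd hp.le_of_seqPath (not_le.2 h)
    rw [drift, hlen, if_neg this]
    split_ifs <;> decide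
  · intro h
    have : ¬ PosetLE (seqPath m x hx n) (n + j) j := fun hp => absurd hp.le_of_seqPath (not_le.2 h)
    rw [drift, hlen, if_neg this]
    split_ifs <;> decide

end OrderPatterns

namespace OrderPatterns

open MultiDigraph

/-! ### An irrational rotation of the unit interval -/

/-- The rotation of the unit interval by `√2`. -/
def rotation (s : unitInterval) : unitInterval :=
  ⟨Int.fract ((s : ℝ) + √2), Int.fract_nonneg _, (Int.fract_lt_one _).le⟩

theorem coe_rotation_iterate {s : unitInterval} (hs : (s : ℝ) < 1) (k : ℕ) :
    (rotation^[k] s : ℝ) = Int.fract ((s : ℝ) + k * √2) := by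
  induction k with
  | zero => simp [Int.fract_eq_self.2 ⟨s.2.1, hs⟩]
  | succ k ih =>
    rw [Function.iterate_succ_apply', rotation]
    simp only [ih]
    rw [Int.fract_eq_fract]
    refine ⟨-⌊(s : ℝ) + k * √2⌋, ?_⟩
    rw [Int.fract]
    push_cast
    ring

theorem rotation_iterate_injective {s : unitInterval} (hs : (s : ℝ) < 1) :
    Function.Injective fun k : ℕ => rotation^[k] s := by
  intro k l h
  have h' : (rotation^[k] s : ℝ) = rotation^[l] s := congrArg _ h
  rw [coe_rotation_iterate hs, coe_rotation_iterate hs, Int.fract_eq_fract] at h'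
  obtain ⟨z, hz⟩ := h'
  by_contra hne
  have h0 : ((k : ℤ) - l : ℤ) ≠ 0 := sub_ne_zero.2 (by exact_mod_cast hne)
  have := irrational_sqrt_two.intCast_mul h0
  refine this ⟨z, ?_⟩
  push_cast
  linarith

theorem ae_coe_lt_one : ∀ᵐ s : unitInterval, (s : ℝ) < 1 := by
  have : ∀ᵐ s : unitInterval, s ≠ 1 := Measure.ae_ne _ _
  filter_upwards [this] with s hs
  exact lt_of_le_of_ne s.2.2 fun h => hs (Subtype.ext h)

/-- Transported from the circle: the projection of the interval to the circle and its almost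
everywhere inverse `e` preserve measure, and between them the rotation is a translation. -/
theorem measurePreserving_rotation :
    MeasurePreserving rotation (volume : Measure unitInterval) volume := by
  have hc : MeasurePreserving (fun s : unitInterval => ((s : ℝ) : UnitAddCircle)) volume volume := by
    have h1 := UnitAddCircle.measurePreserving_mk 0
    have h2 := unitInterval.measurePreserving_coe
    have h3 : (volume : Measure ℝ).restrict (Set.Ioc 0 (0 + 1)) = volume.restrict unitInterval := by
      rw [zero_add]; exact Measure.restrict_congr_set Ioc_ae_eq_Icc
    rw [h3] at h1
    exact h1.comp h2
  let e : UnitAddCircle → unitInterval := fun z =>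
    ⟨(AddCircle.equivIco 1 0 z : ℝ), (AddCircle.equivIco 1 0 z).2.1,
      by simpa using (AddCircle.equivIco 1 0 z).2.2.le⟩
  have hmk : ∀ x : ℝ, (e (x : UnitAddCircle) : ℝ) = Int.fract x := by
    intro x
    have := AddCircle.coe_equivIco_mk_apply (p := (1 : ℝ)) x
    rwa [div_one, mul_one] at this
  have he : Measurable e := by
    refine Measurable.subtype_mk ?_
    exact measurable_subtype_coe.comp (AddCircle.measurableEquivIco 1 0).measurable
  have hem : MeasurePreserving e volume volume := by
    refine ⟨he, ?_⟩
    rw [← hc.map_eq, Measure.map_map he hc.measurable]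
    refine (Measure.map_congr ?_).trans Measure.map_id
    filter_upwards [ae_coe_lt_one] with s hs
    apply Subtype.ext
    rw [Function.comp_apply, hmk, Int.fract_eq_self.2 ⟨s.2.1, hs⟩, id]
  have hadd := measurePreserving_add_right (volume : Measure UnitAddCircle) ((√2 : ℝ) : UnitAddCircle)
  convert hem.comp (hadd.comp hc) using 1
  ext s
  simp only [Function.comp_apply]
  rw [← AddCircle.coe_add, hmk, rotation]

/-! ### Cells of prescribed lengths in the unit interval -/

section Cells

variable {Q : Type*} [Fintype Q] [LinearOrder Q] (w : Q → ℝ)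

/-- The left endpoint of the cell `q`. -/
def cellStart (q : Q) : ℝ := ∑ p with p < q, w p

/-- Consecutive half-open intervals of lengths `w q`. -/
def cell (q : Q) : Set unitInterval :=
  {y | cellStart w q ≤ y ∧ (y : ℝ) < cellStart w q + w q}

/-- The affine map from the unit interval to a cell. -/
def cellMap (q : Q) (s : unitInterval) : unitInterval :=
  Set.projIcc 0 1 zero_le_one (cellStart w q + w q * s)

theorem continuous_cellMap (q : Q) : Continuous (cellMap w q) := by
  unfold cellMap
  exact continuous_projIcc.comp (by fun_prop)

theorem measurableSet_cell (q : Q) : MeasurableSet (cell w q) :=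
  (measurableSet_le measurable_const measurable_subtype_coe).inter
    (measurableSet_lt measurable_subtype_coe measurable_const)

variable {w}

theorem cellStart_nonneg (hw : ∀ q, 0 ≤ w q) (q : Q) : 0 ≤ cellStart w q :=
  Finset.sum_nonneg fun p _ => hw p

theorem cellStart_add_eq (q : Q) : cellStart w q + w q = ∑ p with p ≤ q, w p := by
  classical
  have : (Finset.univ.filter fun p : Q => p ≤ q) =
      insert q (Finset.univ.filter fun p : Q => p < q) := by
    ext p; simp [le_iff_eq_or_lt]
  rw [this, Finset.sum_insert (by simp), cellStart, add_comm]

theorem cellStart_add_le (hw : ∀ q, 0 ≤ w q) {p q : Q} (h : p < q) :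
    cellStart w p + w p ≤ cellStart w q := by
  rw [cellStart_add_eq, cellStart]
  refine Finset.sum_le_sum_of_subset_of_nonneg (fun r hr => ?_) fun r _ _ => hw r
  simp only [Finset.mem_filter, Finset.mem_univ, true_and] at hr ⊢
  exact hr.trans_lt h

theorem cellStart_add_le_one (hw : ∀ q, 0 ≤ w q) (hsum : ∑ q, w q = 1) (q : Q) :
    cellStart w q + w q ≤ 1 := by
  rw [cellStart_add_eq, ← hsum]
  exact Finset.sum_le_sum_of_subset_of_nonneg (Finset.filter_subset _ _) fun r _ _ => hw r

/-- With nonnegative lengths of total 1 the clamping in `cellMap` is inactive. -/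
theorem coe_cellMap (hw : ∀ q, 0 ≤ w q) (hsum : ∑ q, w q = 1) (q : Q) (s : unitInterval) :
    (cellMap w q s : ℝ) = cellStart w q + w q * s := by
  have h1 := cellStart_nonneg hw q
  have h2 := cellStart_add_le_one hw hsum q
  have h3 := mul_nonneg (hw q) s.2.1
  have h4 := mul_le_mul_of_nonneg_left s.2.2 (hw q)
  rw [cellMap, Set.projIcc_of_mem zero_le_one ⟨by linarith, by linarith⟩]

theorem cellMap_mem (hw : ∀ q, 0 ≤ w q) (hsum : ∑ q, w q = 1) {q : Q} (hq : 0 < w q)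
    {s : unitInterval} (hs : (s : ℝ) < 1) : cellMap w q s ∈ cell w q := by
  have h3 := mul_nonneg (hw q) s.2.1
  have h4 := mul_lt_mul_of_pos_left hs hq
  simp only [cell, Set.mem_ofPred_eq, coe_cellMap hw hsum]
  constructor <;> linarith

theorem pos_of_mem_cell {q : Q} {y : unitInterval} (h : y ∈ cell w q) : 0 < w q := by
  have := h.1.trans_lt h.2
  linarith

theorem exists_cellMap_eq (hw : ∀ q, 0 ≤ w q) (hsum : ∑ q, w q = 1) {q : Q} {y : unitInterval}
    (h : y ∈ cell w q) : ∃ s : unitInterval, (s : ℝ) < 1 ∧ cellMap w q s = y := by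
  have hq := pos_of_mem_cell h
  have h1 : 0 ≤ ((y : ℝ) - cellStart w q) / w q := div_nonneg (sub_nonneg.2 h.1) hq.le
  have h2 : ((y : ℝ) - cellStart w q) / w q < 1 := by
    rw [div_lt_one hq]; linarith [h.2]
  refine ⟨⟨_, h1, h2.le⟩, h2, Subtype.ext ?_⟩
  rw [coe_cellMap hw hsum]
  field_simp
  ring

theorem lt_of_mem_cell (hw : ∀ q, 0 ≤ w q) {p q : Q} (h : p < q) {x y : unitInterval}
    (hx : x ∈ cell w p) (hy : y ∈ cell w q) : x < y :=
  Subtype.coe_lt_coe.1 (hx.2.trans_le ((cellStart_add_le hw h).trans hy.1))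

theorem cell_disjoint (hw : ∀ q, 0 ≤ w q) : Pairwise (Function.onFun Disjoint (cell w)) := by
  intro p q hpq
  rw [Function.onFun, Set.disjoint_left]
  intro y hp hq
  rcases lt_or_gt_of_ne hpq with h | h
  · exact lt_irrefl _ (lt_of_mem_cell hw h hp hq)
  · exact lt_irrefl _ (lt_of_mem_cell hw h hq hp)

theorem volume_preimage_cellMap (hw : ∀ q, 0 ≤ w q) (hsum : ∑ q, w q = 1) (q : Q)
    (S : Set unitInterval) :
    ENNReal.ofReal (w q) * volume (cellMap w q ⁻¹' S) = volume (S ∩ cell w q) := by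
  rcases (hw q).lt_or_eq with hq | hq
  · have h1 : volume (cellMap w q ⁻¹' S) = volume (cellMap w q ⁻¹' S ∩ {s | (s : ℝ) < 1}) := by
      refine measure_congr ?_
      filter_upwards [ae_coe_lt_one] with s hs
      simp only [eq_iff_iff]
      exact ⟨fun h => ⟨h, hs⟩, fun h => h.1⟩
    have h2 : Subtype.val '' (cellMap w q ⁻¹' S ∩ {s | (s : ℝ) < 1}) =
        (w q * ·) ⁻¹' ((cellStart w q + ·) ⁻¹' (Subtype.val '' (S ∩ cell w q))) := by
      ext x
      constructor
      · rintro ⟨s, ⟨hs, hs1⟩, rfl⟩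
        exact ⟨cellMap w q s, ⟨hs, cellMap_mem hw hsum hq hs1⟩, coe_cellMap hw hsum q s⟩
      · rintro ⟨y, ⟨hyS, hy⟩, hyx⟩
        obtain ⟨s, hs, rfl⟩ := exists_cellMap_eq hw hsum hy
        refine ⟨s, ⟨hyS, hs⟩, ?_⟩
        rw [coe_cellMap hw hsum] at hyx
        simpa [hq.ne'] using hyx
    rw [h1, unitInterval.volume_apply, h2, Real.volume_preimage_mul_left hq.ne',
      measure_preimage_add, ← mul_assoc, ← ENNReal.ofReal_mul hq.le, abs_of_pos (inv_pos.2 hq),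
      mul_inv_cancel₀ hq.ne', ENNReal.ofReal_one, one_mul, unitInterval.volume_apply]
  · have : cell w q = ∅ := by
      rw [Set.eq_empty_iff_forall_notMem]
      intro y hy
      exact (pos_of_mem_cell hy).ne hq
    simp [← hq, this]

theorem volume_cell (hw : ∀ q, 0 ≤ w q) (hsum : ∑ q, w q = 1) (q : Q) :
    volume (cell w q) = ENNReal.ofReal (w q) := by
  have := volume_preimage_cellMap hw hsum q Set.univ
  simpa using this.symm

theorem ae_mem_cell (hw : ∀ q, 0 ≤ w q) (hsum : ∑ q, w q = 1) :
    ∀ᵐ y : unitInterval, ∃ q, y ∈ cell w q := by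
  have h : volume (⋃ q, cell w q) = 1 := by
    rw [measure_iUnion (cell_disjoint hw) (measurableSet_cell w), tsum_fintype]
    simp only [volume_cell hw hsum]
    rw [← ENNReal.ofReal_sum_of_nonneg fun q _ => hw q, hsum, ENNReal.ofReal_one]
  have := (prob_compl_eq_zero_iff (MeasurableSet.iUnion (measurableSet_cell w))).2 h
  rw [ae_iff]
  convert this using 2
  ext y; simp

/-- This splits Lebesgue measure over the cells, so that invariance can be checked cell by cell in
the unit coordinate. -/
theorem sum_volume_preimage_cellMap (hw : ∀ q, 0 ≤ w q) (hsum : ∑ q, w q = 1)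
    {S : Set unitInterval} (hS : MeasurableSet S) :
    ∑ q, ENNReal.ofReal (w q) * volume (cellMap w q ⁻¹' S) = volume S := by
  simp only [volume_preimage_cellMap hw hsum]
  rw [← tsum_fintype (L := .unconditional _), ← measure_iUnion]
  · rw [← Set.inter_iUnion]
    refine measure_congr ?_
    filter_upwards [ae_mem_cell hw hsum] with y hy
    simp only [eq_iff_iff]
    exact ⟨fun h => h.1, fun h => ⟨h, Set.mem_iUnion.2 hy⟩⟩
  · exact fun p q hpq => (cell_disjoint hw hpq).mono Set.inter_subset_right Set.inter_subset_right
  · exact fun q => hS.inter (measurableSet_cell w q)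

/-! ### Permuting the cells -/

variable (w) in
/-- The map that sends the cell `q` to the cell `π q`, rotating it by an irrational angle. -/
def cellPerm (π : Perm Q) (y : unitInterval) : unitInterval :=
  Set.projIcc 0 1 zero_le_one
    (∑ q, (cell w q).indicator (fun y => cellStart w (π q) + w q *
      Int.fract (((y : ℝ) - cellStart w q) / w q + √2)) y)

theorem measurable_cellPerm (π : Perm Q) : Measurable (cellPerm w π) := by
  refine continuous_projIcc.measurable.comp (Finset.measurable_fun_sum _ fun q _ => ?_)
  refine Measurable.indicator ?_ (measurableSet_cell w q)
  have : Measurable fun y : unitInterval => Int.fract (((y : ℝ) - cellStart w q) / w q + √2) :=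
    measurable_fract.comp (((measurable_subtype_coe.sub_const _).div_const _).add_const _)
  exact (this.const_mul _).const_add _

variable {π : Perm Q}

/-- In the coordinates (cell, position in the cell) the map is the product of `π` and the rotation;
`hπ` makes source and target cells equally long. The permutation alone would make points periodic.
The rotation makes orbits infinite without changing the cells visited, which are what decides the
patterns. -/
theorem cellPerm_cellMap (hw : ∀ q, 0 ≤ w q) (hsum : ∑ q, w q = 1) (hπ : ∀ q, w (π q) = w q)
    {q : Q} (hq : 0 < w q) {s : unitInterval} (hs : (s : ℝ) < 1) :
    cellPerm w π (cellMap w q s) = cellMap w (π q) (rotation s) := by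
  have hmem := cellMap_mem hw hsum hq hs
  rw [cellPerm, Finset.sum_eq_single q]
  · have h : cellMap w (π q) (rotation s) = Set.projIcc 0 1 zero_le_one
        (cellStart w (π q) + w (π q) * Int.fract ((s : ℝ) + √2)) := rfl
    rw [Set.indicator_of_mem hmem, coe_cellMap hw hsum, h, hπ]
    congr 5
    field_simp
    ring
  · intro p _ hpq
    exact Set.indicator_of_notMem (fun h => Set.disjoint_left.1 (cell_disjoint hw hpq) h hmem) _
  · simp

theorem cellPerm_iterate (hw : ∀ q, 0 ≤ w q) (hsum : ∑ q, w q = 1) (hπ : ∀ q, w (π q) = w q)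
    {q : Q} (hq : 0 < w q) {s : unitInterval} (hs : (s : ℝ) < 1) (k : ℕ) :
    0 < w ((π ^ k) q) ∧ (rotation^[k] s : ℝ) < 1 ∧
      (cellPerm w π)^[k] (cellMap w q s) = cellMap w ((π ^ k) q) (rotation^[k] s) := by
  induction k with
  | zero => exact ⟨hq, hs, rfl⟩
  | succ k ih =>
    obtain ⟨h1, h2, h3⟩ := ih
    refine ⟨?_, ?_, ?_⟩
    · rw [pow_succ', Perm.mul_apply, hπ]; exact h1
    · rw [coe_rotation_iterate hs]; exact Int.fract_lt_one _
    · rw [Function.iterate_succ_apply', h3, cellPerm_cellMap hw hsum hπ h1 h2, pow_succ',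
        Perm.mul_apply, Function.iterate_succ_apply']

theorem measurePreserving_cellPerm (hw : ∀ q, 0 ≤ w q) (hsum : ∑ q, w q = 1)
    (hπ : ∀ q, w (π q) = w q) :
    MeasurePreserving (cellPerm w π) (volume : Measure unitInterval) volume := by
  refine ⟨measurable_cellPerm π, Measure.ext fun S hS => ?_⟩
  rw [Measure.map_apply (measurable_cellPerm π) hS,
    ← sum_volume_preimage_cellMap hw hsum (measurable_cellPerm π hS),
    ← sum_volume_preimage_cellMap hw hsum hS, 
    ← Equiv.sum_comp π fun q => ENNReal.ofReal (w q) * volume (cellMap w q ⁻¹' S)]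
  refine Finset.sum_congr rfl fun q _ => ?_
  rw [hπ]
  rcases (hw q).lt_or_eq with hq | hq
  · congr 1
    rw [← measurePreserving_rotation.measure_preimage
      ((continuous_cellMap w (π q)).measurable hS).nullMeasurableSet]
    refine measure_congr ?_
    filter_upwards [ae_coe_lt_one] with s hs
    simp only [eq_iff_iff]
    change cellPerm w π (cellMap w q s) ∈ S ↔ cellMap w (π q) (rotation s) ∈ S
    rw [cellPerm_cellMap hw hsum hπ hq hs]
  · simp [← hq]

theorem cellPerm_iterate_injective (hw : ∀ q, 0 ≤ w q) (hsum : ∑ q, w q = 1)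
    (hπ : ∀ q, w (π q) = w q) {q : Q} {y : unitInterval} (hy : y ∈ cell w q) :
    Function.Injective fun k => (cellPerm w π)^[k] y := by
  obtain ⟨s, hs, rfl⟩ := exists_cellMap_eq hw hsum hy
  have hq := pos_of_mem_cell hy
  intro k l hkl
  obtain ⟨h1, h2, h3⟩ := cellPerm_iterate hw hsum hπ hq hs k
  obtain ⟨h1', h2', h3'⟩ := cellPerm_iterate hw hsum hπ hq hs l
  simp only [h3, h3'] at hkl
  have hqq : (π ^ k) q = (π ^ l) q := by
    by_contra hne
    have m1 := cellMap_mem hw hsum h1 h2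
    have m2 := cellMap_mem hw hsum h1' h2'
    rw [hkl] at m1
    exact Set.disjoint_left.1 (cell_disjoint hw hne) m1 m2
  have := congrArg (Subtype.val) hkl
  rw [coe_cellMap hw hsum, coe_cellMap hw hsum, hqq] at this
  have h5 : (rotation^[k] s : ℝ) = rotation^[l] s :=
    mul_left_cancel₀ h1'.ne' (add_left_cancel this)
  exact rotation_iterate_injective hs (Subtype.ext h5)

theorem cellPerm_mem (hw : ∀ q, 0 ≤ w q) (hsum : ∑ q, w q = 1)
    (hπ : ∀ q, w (π q) = w q) :
    cellPerm w π ∈ aperiodicMeasurePreserving := by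
  have hmp := measurePreserving_cellPerm hw hsum hπ
  refine ⟨?_, (measurable_cellPerm π).nullMeasurable, fun S hS =>
    hmp.measure_preimage hS.nullMeasurableSet⟩
  filter_upwards [ae_mem_cell hw hsum] with y hy
  exact Set.infinite_range_of_injective (cellPerm_iterate_injective hw hsum hπ hy.choose_spec)

/-- The orbit of a point of the cell `q` visits the cells `π ^ c q`. By `hτ` these are distinct and
ordered like `τ q` over one window, so the whole cell has pattern `τ q`. -/
theorem orderDist_cellPerm {n : ℕ} (hw : ∀ q, 0 ≤ w q) (hsum : ∑ q, w q = 1)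
    (hπ : ∀ q, w (π q) = w q) {τ : Q → Perm (Fin n)}
    (hτ : ∀ q c d, τ q c < τ q d → (π ^ (c : ℕ)) q < (π ^ (d : ℕ)) q) (σ : Perm (Fin n)) :
    orderDist n (cellPerm w π) σ = ∑ q with τ q = σ, w q := by
  have hpat : ∀ q, ∀ y ∈ cell w q,
      orderPattern (fun i : Fin n => (cellPerm w π)^[(i : ℕ)] y) = τ q := by
    intro q y hy
    have hinj := cellPerm_iterate_injective hw hsum hπ hy
    have hlt : ∀ c d, τ q c < τ q d → (cellPerm w π)^[(c : ℕ)] y < (cellPerm w π)^[(d : ℕ)] y := by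
      intro c d hcd
      obtain ⟨s, hs, rfl⟩ := exists_cellMap_eq hw hsum hy
      obtain ⟨h1, h2, h3⟩ := cellPerm_iterate hw hsum hπ (pos_of_mem_cell hy) hs c
      obtain ⟨h1', h2', h3'⟩ := cellPerm_iterate hw hsum hπ (pos_of_mem_cell hy) hs d
      rw [h3, h3']
      exact lt_of_mem_cell hw (hτ q c d hcd) (cellMap_mem hw hsum h1 h2)
        (cellMap_mem hw hsum h1' h2')
    rw [orderPattern_eq_iff fun a b hab => Fin.ext (hinj hab)]
    intro c d
    refine ⟨fun h => ?_, hlt c d⟩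
    by_contra hn
    rcases (not_lt.1 hn).lt_or_eq with h' | h'
    · exact lt_asymm h (hlt d c h')
    · rw [(τ q).injective h'] at h
      exact lt_irrefl _ h
  have hset : {x | IsAperiodicPt (cellPerm w π) x ∧
      orderPattern (fun i : Fin n => (cellPerm w π)^[(i : ℕ)] x) = σ} =ᵐ[volume]
      ⋃ q ∈ Finset.univ.filter (fun q => τ q = σ), cell w q := by
    filter_upwards [ae_mem_cell hw hsum] with y hy
    obtain ⟨q, hq⟩ := hy
    simp only [eq_iff_iff]
    change (_ ∧ _) ↔ y ∈ ⋃ q ∈ Finset.univ.filter (fun q => τ q = σ), cell w q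
    simp only [Finset.mem_filter, Finset.mem_univ, true_and, Set.mem_iUnion, exists_prop]
    rw [hpat q y hq]
    constructor
    · rintro ⟨-, h⟩; exact ⟨q, h, hq⟩
    · rintro ⟨p, hp, hyp⟩
      rw [← hpat p y hyp, hpat q y hq] at hp
      exact ⟨Set.infinite_range_of_injective (cellPerm_iterate_injective hw hsum hπ hq), hp⟩
  rw [orderDist, Measure.real, measure_congr hset, measure_biUnion_finset
    (fun p _ q _ hpq => cell_disjoint hw hpq) (fun q _ => measurableSet_cell w q)]
  simp only [volume_cell hw hsum]
  rw [← ENNReal.ofReal_sum_of_nonneg fun q _ => hw q,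
    ENNReal.toReal_ofReal (Finset.sum_nonneg fun q _ => hw q)]

end Cells

/-! ### Cyclic walks are realizable -/

theorem coe_finRotate_pow (n c : ℕ) (k : Fin n) : (((finRotate n) ^ c) k : ℕ) = (k + c) % n := by
  induction c with
  | zero => simp [Nat.mod_eq_of_lt k.2]
  | succ c ih =>
    obtain _ | n := n
    · exact k.elim0
    · rw [pow_succ', Perm.mul_apply, finRotate_apply, Fin.val_add, ih]
      simp [Nat.add_assoc]

theorem sum_ite_getElem_eq {E : Type*} [DecidableEq E] (l : List E) (a : E) :
    ∑ k : Fin l.length, (if l[k] = a then (1 : ℝ) else 0) = countVec l a := by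
  induction l with
  | nil => simp [countVec]
  | cons e l ih =>
    rw [← List.singleton_append, countVec_append, Pi.add_apply, ← ih]
    have := Fin.sum_univ_succ fun k : Fin (l.length + 1) =>
      if (e :: l)[k] = a then (1 : ℝ) else 0
    refine this.trans ?_
    congr 1
    by_cases h : e = a
    · simp [countVec, h]
    · simp [countVec, h]

/-- There is one cell of length `c i` for each position in `L i`, and `π` advances positions
cyclically. The cells of one list are placed in the order of its periodic realization. -/
theorem mem_realizable_of_isCyclic {m n : ℕ} {c : Fin n → ℝ} (hc : ∀ i, 0 ≤ c i)
    {L : Fin n → List (Perm (Fin (m + 1)))} (hL : ∀ i, IsCyclic (L i))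
    {φ : Perm (Fin (m + 1)) → ℝ} (hφ : φ = ∑ i, c i • countVec (L i)) (hsum : ∑ e, φ e = 1) :
    φ ∈ realizable (m + 1) := by
  classical
  choose x hx using hL
  let Q := Σ i : Fin n, Fin (L i).length
  -- Orbits stay within one list, so the order between lists is immaterial. The position only breaks
  -- ties of `x i`; the comparisons that matter are strict.
  let key : Q → Fin n ×ₗ (ℚ ×ₗ ℕ) := fun q => toLex (q.1, toLex (x q.1 q.2, (q.2 : ℕ)))
  have hkey : Function.Injective key := by
    rintro ⟨i, k⟩ ⟨j, l⟩ h
    simp only [key, EmbeddingLike.apply_eq_iff_eq, Prod.mk.injEq] at h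
    obtain ⟨rfl, -, h⟩ := h
    rw [Fin.ext h]
  let _ : LinearOrder Q := LinearOrder.lift' key hkey
  let π : Perm Q := Equiv.sigmaCongrRight fun i => finRotate (L i).length
  have hπc : ∀ (a : ℕ) (q : Q), (π ^ a) q = ⟨q.1, (finRotate (L q.1).length ^ a) q.2⟩ := by
    intro a q
    induction a with
    | zero => rfl
    | succ a ih => rw [pow_succ', Perm.mul_apply, ih, pow_succ', Perm.mul_apply]; rfl
  let w : Q → ℝ := fun q => c q.1
  let τ : Q → Perm (Fin (m + 1)) := fun q => (L q.1)[q.2]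
  have hval : ∀ σ, ∑ q with τ q = σ, w q = φ σ := by
    intro σ
    rw [hφ, Finset.sum_filter, Fintype.sum_sigma]
    simp only [Finset.sum_apply, Pi.smul_apply, smul_eq_mul]
    refine Finset.sum_congr rfl fun i _ => ?_
    rw [← sum_ite_getElem_eq, Finset.mul_sum]
    refine Finset.sum_congr rfl fun k _ => ?_
    rw [mul_ite, mul_one, mul_zero]
  have hw : ∀ q, 0 ≤ w q := fun q => hc q.1
  have hwsum : ∑ q, w q = 1 := by
    rw [← hsum, ← Finset.sum_fiberwise (g := τ)]
    exact Finset.sum_congr rfl fun σ _ => hval σ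
  have hwπ : ∀ q, w (π q) = w q := fun q => rfl
  refine ⟨cellPerm w π, cellPerm_mem hw hwsum hwπ, funext fun σ => ?_⟩
  rw [orderDist_cellPerm hw hwsum hwπ (τ := τ), hval]
  rintro ⟨i, k⟩ a b hab
  have h := hx i k k.2 a b hab
  rw [hπc, hπc]
  change key _ < key _
  simp only [key, Prod.Lex.toLex_lt_toLex]
  refine Or.inr ⟨trivial, Or.inl ?_⟩
  rw [coe_finRotate_pow, coe_finRotate_pow]
  exact h

end OrderPatterns

namespace OrderPatterns

open MultiDigraph Filter

/-! ### Order patterns along orbits -/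

theorem IsAperiodicPt.iterate_injective {α : Type*} {f : α → α} {x : α} (h : IsAperiodicPt f x) :
    Function.Injective fun k : ℕ => f^[k] x := by
  classical
  intro k l hkl
  by_contra hne
  wlog hlt : k < l generalizing k l
  · exact this hkl.symm (Ne.symm hne) (by omega)
  refine h (((Finset.range l).image fun i => f^[i] x).finite_toSet.subset ?_)
  rintro _ ⟨n, rfl⟩
  simp only [Finset.coe_image, Set.mem_image, Finset.coe_range, Set.mem_Iio]
  induction n using Nat.strong_induction_on with
  | _ n ih =>
    rcases lt_or_ge n l with hn | hn
    · exact ⟨n, hn, rfl⟩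
    · obtain ⟨a, rfl⟩ := Nat.exists_eq_add_of_le hn
      obtain ⟨i, hi, hi'⟩ := ih (k + a) (by omega)
      refine ⟨i, hi, hi'.trans ?_⟩
      simp only at hkl ⊢
      rw [add_comm k, add_comm l, Function.iterate_add_apply, hkl, ← Function.iterate_add_apply]

/-- The order pattern of `(x, g x, …, g^{n-1} x)`. -/
def orbitPattern {α : Type*} [LinearOrder α] (g : α → α) (n : ℕ) (x : α) : Perm (Fin n) :=
  orderPattern fun i : Fin n => g^[(i : ℕ)] x

theorem rho_orbitPattern {α : Type*} [LinearOrder α] {g : α → α} {x : α}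
    (h : Function.Injective fun k : ℕ => g^[k] x) (m : ℕ) :
    rho (orbitPattern g (m + 1) x) = orbitPattern g m x :=
  rho_orderPattern fun _ _ hab => Fin.ext (h hab)

theorem rho'_orbitPattern {α : Type*} [LinearOrder α] {g : α → α} {x : α}
    (h : Function.Injective fun k : ℕ => g^[k] x) (m : ℕ) :
    rho' (orbitPattern g (m + 1) x) = orbitPattern g m (g x) :=
  rho'_orderPattern fun _ _ hab => Fin.ext (h hab)

variable {g : unitInterval → unitInterval}

theorem nullMeasurableSet_orbitPattern (hg : Measurable g)
    (hinj : ∀ᵐ x, Function.Injective fun k : ℕ => g^[k] x) (n : ℕ) (σ : Perm (Fin n)) :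
    NullMeasurableSet {x | orbitPattern g n x = σ} := by
  have hm : MeasurableSet {x | ∀ i j : Fin n, g^[(i : ℕ)] x < g^[(j : ℕ)] x ↔ σ i < σ j} := by
    simp only [Set.ofPred_forall]
    refine MeasurableSet.iInter fun i => MeasurableSet.iInter fun j => ?_
    exact (measurableSet_lt (hg.iterate i) (hg.iterate j)).iff (MeasurableSet.const _)
  refine hm.nullMeasurableSet.congr ?_
  filter_upwards [hinj] with x hx
  simp only [eq_iff_iff]
  exact (orderPattern_eq_iff fun a b hab => Fin.ext (hx hab)).symm

theorem sum_measureReal_orbitPattern (hg : Measurable g)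
    (hinj : ∀ᵐ x, Function.Injective fun k : ℕ => g^[k] x) (n : ℕ) (P : Perm (Fin n) → Prop)
    [DecidablePred P] :
    ∑ σ with P σ, (volume : Measure unitInterval).real {x | orbitPattern g n x = σ} =
      (volume : Measure unitInterval).real {x | P (orbitPattern g n x)} := by
  have h : {x | P (orbitPattern g n x)} =
      ⋃ σ ∈ Finset.univ.filter P, {x | orbitPattern g n x = σ} := by
    ext x; simp
  rw [h, Measure.real, measure_biUnion_finset₀, ENNReal.toReal_sum]
  · rfl
  · exact fun _ _ => measure_ne_top _ _
  · intro σ _ τ _ hne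
    refine Disjoint.aedisjoint (Set.disjoint_left.2 ?_)
    rintro x (rfl : orbitPattern g n x = σ) (h' : orbitPattern g n x = τ)
    exact hne h'
  · exact fun σ _ => nullMeasurableSet_orbitPattern hg hinj n σ

/-- An almost aperiodic measure preserving map may be replaced by a Borel measurable one. -/
theorem exists_measurable_model {f : unitInterval → unitInterval}
    (hf : f ∈ aperiodicMeasurePreserving) :
    ∃ g : unitInterval → unitInterval, MeasurePreserving g volume volume ∧
      (∀ᵐ x, Function.Injective fun k : ℕ => g^[k] x) ∧
      ∀ n σ, orderDist n f σ =
        (volume : Measure unitInterval).real {x | orbitPattern g n x = σ} := by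
  obtain ⟨hap, hnull, hpres⟩ := hf
  have hae := hnull.aemeasurable
  have hg : Measurable (hae.mk f) := hae.measurable_mk
  have hmp : MeasurePreserving (hae.mk f) volume volume := by
    refine ⟨hg, Measure.ext fun S hS => ?_⟩
    rw [Measure.map_apply hg hS, ← hpres S hS]
    exact measure_congr (hae.ae_eq_mk.symm.preimage S)
  -- Agreement almost everywhere passes to whole orbits, since preimages of null sets under the
  -- iterates of the model are null.
  have hit : ∀ᵐ x, ∀ k : ℕ, (hae.mk f)^[k] x = f^[k] x := by
    have : ∀ᵐ x, ∀ k : ℕ, f ((hae.mk f)^[k] x) = hae.mk f ((hae.mk f)^[k] x) :=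
      ae_all_iff.2 fun k =>
        (hmp.iterate k).quasiMeasurePreserving.ae hae.ae_eq_mk
    filter_upwards [this] with x hx k
    induction k with
    | zero => rfl
    | succ k ih => rw [Function.iterate_succ_apply', Function.iterate_succ_apply', ← hx, ih]
  refine ⟨hae.mk f, hmp, ?_, fun n σ => ?_⟩
  · filter_upwards [hap, hit] with x hx hk
    simp only [hk]
    exact hx.iterate_injective
  · refine congrArg ENNReal.toReal (measure_congr ?_)
    filter_upwards [hap, hit] with x hx hk
    simp only [eq_iff_iff]
    change (_ ∧ _) ↔ orbitPattern _ n x = σ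
    simp only [orbitPattern, hk]
    exact ⟨fun h => h.2, fun h => ⟨hx, h⟩⟩

/-- The mass leaving `v` is the measure of the points with pattern `v`; the mass entering `v` is the
measure of the preimage of that set. Invariance equates them. -/
theorem orderDist_mem_flowPolytope {m : ℕ} {f : unitInterval → unitInterval}
    (hf : f ∈ aperiodicMeasurePreserving) :
    orderDist (m + 1) f ∈ (permDigraph m).flowPolytope := by
  obtain ⟨g, hmp, hinj, hd⟩ := exists_measurable_model hf
  have hg := hmp.measurable
  refine mem_flowPolytope.2 ⟨fun e => measureReal_nonneg, ?_, fun v => ?_⟩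
  · have := sum_measureReal_orbitPattern hg hinj (m + 1) fun _ => True
    simp only [hd]
    simpa using this
  · simp only [hd]
    refine (sum_measureReal_orbitPattern hg hinj (m + 1) _).trans
      (Eq.trans ?_ (sum_measureReal_orbitPattern hg hinj (m + 1) _).symm)
    have h1 : (volume : Measure unitInterval)
        {x | (permDigraph m).head (orbitPattern g (m + 1) x) = v} =
        volume {x | orbitPattern g m x = v} := by
      refine measure_congr ?_
      filter_upwards [hinj] with x hx
      simp only [eq_iff_iff]
      change rho _ = v ↔ orbitPattern g m x = v
      rw [rho_orbitPattern hx]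
    have h2 : (volume : Measure unitInterval)
        {x | (permDigraph m).tail (orbitPattern g (m + 1) x) = v} =
        volume (g ⁻¹' {x | orbitPattern g m x = v}) := by
      refine measure_congr ?_
      filter_upwards [hinj] with x hx
      simp only [eq_iff_iff]
      change rho' _ = v ↔ orbitPattern g m (g x) = v
      rw [rho'_orbitPattern hx]
    rw [Measure.real, Measure.real, h1, h2,
      hmp.measure_preimage (nullMeasurableSet_orbitPattern hg hinj m v)]

/-! ### Recurrence excludes drift -/

/-- Along an orbit in a drifting component, the drifting entry moves strictly in one direction
between visits to the base vertex. -/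
theorem lt_of_drift {m : ℕ} {α : Type*} [LinearOrder α] {H : (permDigraph m).Subgraph}
    {v' v : Perm (Fin m)} (hv : v ∈ (H.component v').verts) {j : Fin m} {ε : SignType}
    (hall : ∀ γ : (permDigraph m).Path, γ.IsLoopAt v → γ.IsIn (H.component v') → 0 < γ.length →
      drift γ j j = ε) {g : α → α} {x : α} (hx : Function.Injective fun k : ℕ => g^[k] x)
    (hH : ∀ k, orbitPattern g (m + 1) (g^[k] x) ∈ H.edges) {a b : ℕ} (hab : a < b)
    (ha : orbitPattern g m (g^[a] x) = v) (hb : orbitPattern g m (g^[b] x) = v) :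
    (ε = 1 → g^[a + j] x < g^[b + j] x) ∧ (ε = -1 → g^[b + j] x < g^[a + j] x) := by
  have hy : Function.Injective fun i : ℕ => g^[a + i] x := fun p q hpq => by
    simpa using hx hpq
  set γ := seqPath m (fun i : ℕ => g^[a + i] x) hy (b - a) with hγ
  have hpat : ∀ n k : ℕ, orderPattern (fun i : Fin n => g^[a + (k + i)] x) =
      orbitPattern g n (g^[a + k] x) := by
    intro n k
    rw [orbitPattern]
    congr 1; ext i
    rw [← Function.iterate_add_apply]
    exact congrArg (fun n => g^[n] x) (by omega)
  have h0 : γ.vert 0 = v := (hpat m 0).trans ha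
  have h1 : γ.vert (Fin.last _) = v := by
    refine (hpat m (b - a)).trans ?_
    rw [Nat.add_sub_cancel' hab.le, hb]
  have hedges : ∀ e ∈ γ.edges, e ∈ H.edges := by
    intro e he
    obtain ⟨i, rfl⟩ : ∃ i, γ.edge i = e := by simpa [Path.edges] using he
    have h : γ.edge i = orbitPattern g (m + 1) (g^[a + i] x) := hpat (m + 1) i
    rw [h]
    exact hH _
  have hin : γ.IsIn (H.component v') := by
    refine γ.isIn_of_edges _ (h0 ▸ hv) ?_
    exact γ.isWalk_edges.mem_component hedges (h0 ▸ hv.2)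
  have hd := hall γ ⟨h0, h1⟩ hin (Nat.sub_pos_of_lt hab)
  have hlen : γ.length = b - a := rfl
  have hne : g^[a + j] x ≠ g^[b + j] x := fun h => by
    have : a + (j : ℕ) = b + j := hx h
    omega
  have hbj : a + (b - a + (j : ℕ)) = b + j := by omega
  rw [drift, hlen] at hd
  constructor
  · rintro rfl
    have c : PosetLE γ j (b - a + j) := by
      by_contra h
      rw [if_neg h] at hd
      split_ifs at hd
    have := PosetLE.le_of_seqPath c
    rw [hbj] at this
    exact lt_of_le_of_ne this hne
  · rintro rfl
    have c : PosetLE γ (b - a + j) j := by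
      by_contra h
      rw [if_neg h] at hd
      split_ifs at hd
    have := PosetLE.le_of_seqPath c
    rw [hbj] at this
    exact lt_of_le_of_ne this hne.symm

/-- Multiplied by the sign of the drift, the drifting entry (`key`) strictly increases between
visits to `v`. Recurrence to all the sets "pattern `v`, `key` below the rational `q`" makes this
impossible. -/
theorem driftless_supportSubgraph {m : ℕ} {f : unitInterval → unitInterval}
    (hf : f ∈ aperiodicMeasurePreserving) :
    Driftless ((permDigraph m).supportSubgraph (orderDist (m + 1) f)) := by
  obtain ⟨g, hmp, hinj, hd⟩ := exists_measurable_model hf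
  have hg := hmp.measurable
  set H := (permDigraph m).supportSubgraph (orderDist (m + 1) f) with hHdef
  rintro ⟨v', -, v, hv, j, ε, hε, hall⟩
  have hpatm := nullMeasurableSet_orbitPattern hg hinj m v
  -- the pattern `v` has positive probability
  have hA : volume {x | orbitPattern g m x = v} ≠ 0 := by
    intro hA
    obtain ⟨e, he, hev⟩ := hv.1
    have he' : volume {x | orbitPattern g (m + 1) x = e} ≠ 0 := by
      intro h0
      rw [hd, Measure.real, h0] at he
      exact lt_irrefl _ he
    apply he'
    rcases hev with rfl | rfl
    · refine measure_mono_null_ae ?_ hA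
      filter_upwards [hinj] with x hx
      rintro (h : orbitPattern g (m + 1) x = e)
      change orbitPattern g m x = rho e
      rw [← h, rho_orbitPattern hx]
    · rw [← hmp.measure_preimage hpatm] at hA
      refine measure_mono_null_ae ?_ hA
      filter_upwards [hinj] with x hx
      rintro (h : orbitPattern g (m + 1) x = e)
      change orbitPattern g m (g x) = rho' e
      rw [← h, rho'_orbitPattern hx]
  have hedge : ∀ᵐ x, orbitPattern g (m + 1) x ∈ H.edges := by
    have : ∀ᵐ x, ∀ e, e ∉ H.edges → orbitPattern g (m + 1) x ≠ e := by
      refine ae_all_iff.2 fun e => ?_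
      by_cases he : e ∈ H.edges
      · exact ae_of_all _ fun x h => absurd he h
      · have h0 : orderDist (m + 1) f e = 0 :=
          le_antisymm (not_lt.1 he) measureReal_nonneg
        rw [hd, measureReal_eq_zero_iff] at h0
        have : ∀ᵐ x, ¬ orbitPattern g (m + 1) x = e := by
          rw [ae_iff]; simpa using h0
        filter_upwards [this] with x hx _ using hx
    filter_upwards [this] with x hx
    by_contra hn
    exact hx _ hn rfl
  have hedges : ∀ᵐ x, ∀ k : ℕ, orbitPattern g (m + 1) (g^[k] x) ∈ H.edges :=
    ae_all_iff.2 fun k => (hmp.iterate k).quasiMeasurePreserving.ae hedge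
  let key : unitInterval → ℝ := fun x => (ε : ℝ) * (g^[(j : ℕ)] x : ℝ)
  have hkey : Measurable key := ((hg.iterate j).subtype_val).const_mul _
  have hrec : ∀ᵐ x, ∀ q : ℚ, orbitPattern g m x = v ∧ key x < q →
      ∃ᶠ n in atTop, orbitPattern g m (g^[n] x) = v ∧ key (g^[n] x) < q :=
    ae_all_iff.2 fun q => hmp.conservative.ae_mem_imp_frequently_image_mem
      (s := {x | orbitPattern g m x = v} ∩ {x | key x < q})
      (hpatm.inter (measurableSet_lt hkey measurable_const).nullMeasurableSet)
  obtain ⟨x, hxv, hx, hxe, hxr⟩ : ∃ x, orbitPattern g m x = v ∧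
      (Function.Injective fun k : ℕ => g^[k] x) ∧
      (∀ k : ℕ, orbitPattern g (m + 1) (g^[k] x) ∈ H.edges) ∧
      ∀ q : ℚ, orbitPattern g m x = v ∧ key x < q →
        ∃ᶠ n in atTop, orbitPattern g m (g^[n] x) = v ∧ key (g^[n] x) < q := by
    have h1 : ∃ᶠ x in ae volume, orbitPattern g m x = v := frequently_ae_iff.2 hA
    obtain ⟨x, h⟩ := (h1.and_eventually (hinj.and (hedges.and hrec))).exists
    exact ⟨x, h⟩
  have hmono : ∀ a b, a < b → orbitPattern g m (g^[a] x) = v → orbitPattern g m (g^[b] x) = v →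
      key (g^[a] x) < key (g^[b] x) := by
    intro a b hab ha hb
    obtain ⟨h1, h2⟩ := lt_of_drift hv hall hx hxe hab ha hb
    simp only [key, ← Function.iterate_add_apply, add_comm (j : ℕ)]
    cases ε with
    | zero => exact absurd rfl hε
    | pos => simpa using h1 rfl
    | neg => simpa using h2 rfl
  -- `q₀` only serves to produce a first return `n₁`. A rational `q` between the entries at times 0
  -- and `n₁` then gives a later return `n₂` below `q`, against monotonicity.
  obtain ⟨q₀, hq₀⟩ := exists_rat_gt (key x)
  obtain ⟨n₁, hn₁, hv₁, -⟩ := (frequently_atTop.1 (hxr q₀ ⟨hxv, hq₀⟩)) 1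
  obtain ⟨q, hq, hq'⟩ := exists_rat_btwn (hmono 0 n₁ hn₁ hxv hv₁)
  obtain ⟨n₂, hn₂, hv₂, hk₂⟩ := (frequently_atTop.1 (hxr q ⟨hxv, hq⟩)) (n₁ + 1)
  exact lt_asymm (hmono n₁ n₂ hn₂ hv₁ hv₂) (hk₂.trans hq')

end OrderPatterns

namespace OrderPatterns

open MultiDigraph

/-! ### Positive flows on driftless subgraphs are realizable -/

theorem MultiDigraph.IsWalk.flatten_replicate {V E : Type*} {G : MultiDigraph V E} {v : V}
    {l : List E} (h : G.IsWalk v l v) (n : ℕ) : G.IsWalk v (List.replicate n l).flatten v := by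
  induction n with
  | zero => rfl
  | succ n ih => rw [List.replicate_succ, List.flatten_cons]; exact h.append ih

theorem MultiDigraph.countVec_flatten_replicate {E : Type*} (l : List E) (n : ℕ) :
    countVec (List.replicate n l).flatten = (n : ℝ) • countVec l := by
  induction n with
  | zero => simp [countVec_nil]
  | succ n ih =>
    rw [List.replicate_succ, List.flatten_cons, countVec_append, ih]
    push_cast
    module

/-- The cone of nonnegative combinations of cyclically realizable closed walks. -/
def cyclicCone (m : ℕ) : Submodule NNReal (Perm (Fin (m + 1)) → ℝ) :=
  Submodule.span NNReal {χ | ∃ l, IsCyclic l ∧ χ = countVec l}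

variable {m : ℕ}

theorem smul_countVec_mem_cyclicCone {l : List (Perm (Fin (m + 1)))} (h : IsCyclic l) {s : ℝ}
    (hs : 0 ≤ s) : s • countVec l ∈ cyclicCone m :=
  Submodule.smul_mem _ (⟨s, hs⟩ : NNReal) (Submodule.subset_span ⟨l, h, rfl⟩)

/-- One copy of `l` makes arbitrarily many copies of `g` cyclic. With `D > 1 / s`, the walk `l`
followed by `D` copies of `g`, weighted by `1 / D`, uses up `g` and only `1 / D` of `l`; the rest of
`l` is cyclic by itself. -/
theorem IsSeparating.add_mem_cyclicCone {v : Perm (Fin m)} {l g : List (Perm (Fin (m + 1)))}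
    (hl : (permDigraph m).IsWalk v l v) (hs : IsSeparating l)
    (hg : (permDigraph m).IsWalk v g v) {s : ℝ} (h0 : 0 < s) :
    s • countVec l + countVec g ∈ cyclicCone m := by
  obtain ⟨D, hD⟩ := exists_nat_gt (1 / s)
  have hD0 : (0 : ℝ) < D := (one_div_pos.2 h0).trans hD
  have hle : 1 / (D : ℝ) ≤ s := by
    rw [div_le_iff₀ hD0]
    rw [div_lt_iff₀ h0] at hD
    linarith
  have h1 := hs.isCyclic_append hl (hg.flatten_replicate D)
  have h2 := hs.isCyclic_append hl (hg.flatten_replicate 0)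
  have := (cyclicCone m).add_mem (smul_countVec_mem_cyclicCone h2 (sub_nonneg.2 hle))
    (smul_countVec_mem_cyclicCone h1 (one_div_pos.2 hD0).le)
  convert this using 1
  rw [countVec_append, countVec_append, countVec_flatten_replicate, countVec_flatten_replicate]
  ext e
  simp only [Pi.add_apply, Pi.smul_apply, smul_eq_mul, Nat.cast_zero, zero_mul]
  field_simp
  ring

theorem mem_realizable_of_mem_cyclicCone {φ : Perm (Fin (m + 1)) → ℝ} (h : φ ∈ cyclicCone m)
    (hsum : ∑ e, φ e = 1) : φ ∈ realizable (m + 1) := by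
  obtain ⟨n, c, g, hφ⟩ := Submodule.mem_span_set'.1 h
  choose L hL hLg using fun i => (g i).2
  refine mem_realizable_of_isCyclic (c := fun i => (c i : ℝ)) (fun i => (c i).2) hL ?_ hsum
  rw [← hφ]
  exact Finset.sum_congr rfl fun i _ => by rw [hLg i]; rfl

theorem Driftless.mem_realizable {H : (permDigraph m).Subgraph} (hD : Driftless H)
    (hH : H.IsFaceSubgraph) {φ : Perm (Fin (m + 1)) → ℝ} (hφ : φ ∈ H.face)
    (hpos : ∀ e ∈ H.edges, 0 < φ e) : φ ∈ realizable (m + 1) := by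
  classical
  obtain ⟨h0, hsum, hflow⟩ := mem_flowPolytope.1 hφ.1
  choose! Z hZ hZne hZH hZs using fun v (hv : v ∈ H.verts) => hD.exists_isSeparating hH hv
  set u : Perm (Fin (m + 1)) → ℝ := ∑ v with v ∈ H.verts, countVec (Z v) with hu
  have huH : ∀ e, e ∉ H.edges → u e = 0 := by
    intro e he
    rw [hu, Finset.sum_apply]
    refine Finset.sum_eq_zero fun v hv => countVec_eq_zero fun h => he ?_
    exact hZH v (by simpa using hv) e h
  have huflow : (permDigraph m).IsFlow u := by
    refine IsFlow.sum _ fun v hv => ?_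
    exact (hZ v (by simpa using hv)).isFlow_countVec
  have hcyc : ∀ v ∈ H.verts, IsCyclic (Z v) := by
    intro v hv
    have := (hZs v hv).isCyclic_append (hZ v hv) (g := []) rfl
    rwa [List.append_nil] at this
  -- Since every `s > 0` is allowed, the share of `u` can be halved for a sum and rescaled for a
  -- multiple.
  have key : ∀ ψ ∈ Submodule.span NNReal {χ | ∃ v l, (permDigraph m).IsWalk v l v ∧ l ≠ [] ∧
      (∀ e ∈ l, e ∈ H.edges) ∧ χ = countVec l}, ∀ s : ℝ, 0 < s → s • u + ψ ∈ cyclicCone m := by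
    have hsu : ∀ s : ℝ, 0 < s → s • u ∈ cyclicCone m := by
      intro s hs
      rw [hu, Finset.smul_sum]
      exact Submodule.sum_mem _ fun v hv =>
        smul_countVec_mem_cyclicCone (hcyc v (by simpa using hv)) hs.le
    intro ψ hψ
    induction hψ using Submodule.span_induction with
    | zero => intro s hs; rw [add_zero]; exact hsu s hs
    | add x y _ _ hx hy =>
      intro s hs
      have := (cyclicCone m).add_mem (hx (s / 2) (by positivity)) (hy (s / 2) (by positivity))
      convert this using 1
      module
    | smul c x _ hx =>
      intro s hs
      rcases eq_or_ne c 0 with rfl | hc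
      · rw [zero_smul, add_zero]; exact hsu s hs
      · have hc' : (0 : ℝ) < c := NNReal.coe_pos.2 (pos_iff_ne_zero.2 hc)
        have := (cyclicCone m).smul_mem c (hx (s / c) (by positivity))
        convert this using 1
        rw [smul_add]
        congr 1
        change s • u = (c : ℝ) • ((s / c : ℝ) • u)
        rw [smul_smul, mul_div_cancel₀ _ hc'.ne']
    | mem χ hχ =>
      obtain ⟨v, l, hl, hl0, hlH, rfl⟩ := hχ
      intro s hs
      have hv : v ∈ H.verts := by
        cases l with
        | nil => exact absurd rfl hl0
        | cons e l => rw [← hl.1]; exact H.head_mem e (hlH e (by simp))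
      -- The loop is absorbed by the separating loop at its own base vertex; the other separating
      -- loops are cyclic as they stand.
      rw [hu, ← Finset.add_sum_erase _ _ (show v ∈ Finset.univ.filter (· ∈ H.verts) by simpa using hv),
        smul_add, add_right_comm, Finset.smul_sum]
      refine Submodule.add_mem _ ((hZs v hv).add_mem_cyclicCone (hZ v hv) hl hs)
        (Submodule.sum_mem _ fun w hw => ?_)
      have hw' : w ∈ H.verts := by simpa using (Finset.mem_erase.1 hw).2
      exact smul_countVec_mem_cyclicCone (hcyc w hw') hs.le
  -- `u` is supported on `H`, where `φ` is positive, so a small multiple of it can be subtracted.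
  obtain ⟨s, hs, hsle⟩ : ∃ s : ℝ, 0 < s ∧ ∀ e, 0 ≤ (φ - s • u) e := by
    have hev : ∀ e, ∀ᶠ s in nhdsWithin (0 : ℝ) (Set.Ioi 0), 0 ≤ (φ - s • u) e := by
      intro e
      by_cases he : e ∈ H.edges
      · have hc : Filter.Tendsto (fun s : ℝ => φ e - s * u e) (nhdsWithin 0 (Set.Ioi 0))
            (nhds (φ e - 0 * u e)) :=
          (Continuous.tendsto (by fun_prop) 0).mono_left nhdsWithin_le_nhds
        filter_upwards [hc.eventually (lt_mem_nhds (by simpa using hpos e he : (0 : ℝ) < _))]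
          with s hs
        simpa using hs.le
      · filter_upwards with s
        simp [huH e he, hφ.2 e he]
    obtain ⟨s, h1, h2⟩ := ((Filter.eventually_all.2 hev).and self_mem_nhdsWithin).exists
    exact ⟨s, h2, h1⟩
  have hψ := (hflow.sub (huflow.smul s)).mem_span hsle
  have hmem := key (φ - s • u) (Submodule.span_mono (by
    rintro χ ⟨v, l, hl, hl0, hlp, rfl⟩
    refine ⟨v, l, hl, hl0, fun e he => ?_, rfl⟩
    by_contra hn
    have := hlp e he
    simp [huH e hn, hφ.2 e hn] at this) hψ) s hs
  rw [add_sub_cancel] at hmem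
  exact mem_realizable_of_mem_cyclicCone hmem hsum

/-! ### The whole permutation digraph is driftless -/

/-- The pattern `τ` repeated, each copy being shifted by `c` times the length. -/
def shiftSeq {n : ℕ} (hn : 0 < n) (τ : Perm (Fin n)) (c : ℤ) (i : ℕ) : ℤ :=
  (τ ⟨i % n, Nat.mod_lt _ hn⟩ : ℕ) + n * (c * (i / n : ℕ))

theorem shiftSeq_injective {n : ℕ} (hn : 0 < n) (τ : Perm (Fin n)) {c : ℤ} (hc : c ≠ 0) :
    Function.Injective (shiftSeq hn τ c) := by
  intro i j hij
  have hmod : ∀ i, shiftSeq hn τ c i % n = (τ ⟨i % n, Nat.mod_lt _ hn⟩ : ℕ) := by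
    intro i
    rw [shiftSeq, Int.add_mul_emod_self_left]
    exact Int.emod_eq_of_lt (by positivity) (by exact_mod_cast (τ _).2)
  have h1 : (τ ⟨i % n, Nat.mod_lt _ hn⟩ : ℕ) = τ ⟨j % n, Nat.mod_lt _ hn⟩ := by
    have := hmod i
    rw [hij, hmod] at this
    exact_mod_cast this.symm
  have h2 : i % n = j % n := by simpa using τ.injective (Fin.ext h1)
  rw [shiftSeq, shiftSeq, h1, add_right_inj] at hij
  have h3 : c * (i / n : ℕ) = c * (j / n : ℕ) :=
    mul_left_cancel₀ (by exact_mod_cast hn.ne') hij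
  have h4 : i / n = j / n := by exact_mod_cast mul_left_cancel₀ hc h3
  rw [← Nat.div_add_mod i n, ← Nat.div_add_mod j n, h2, h4]

theorem shiftSeq_of_lt {n : ℕ} (hn : 0 < n) (τ : Perm (Fin n)) (c : ℤ) (i : Fin n) :
    shiftSeq hn τ c i = (τ i : ℕ) := by
  simp [shiftSeq, Nat.mod_eq_of_lt i.2, Nat.div_eq_of_lt i.2]

theorem shiftSeq_add {n : ℕ} (hn : 0 < n) (τ : Perm (Fin n)) (c : ℤ) (i : ℕ) :
    shiftSeq hn τ c (n + i) = shiftSeq hn τ c i + n * c := by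
  simp only [shiftSeq, Nat.add_mod_left, Nat.add_div_left _ hn]
  push_cast
  ring

theorem orderPattern_shiftSeq {n : ℕ} (hn : 0 < n) (τ : Perm (Fin n)) {c : ℤ} (hc : c ≠ 0) :
    orderPattern (fun i : Fin n => shiftSeq hn τ c (0 + i)) = τ := by
  rw [orderPattern_eq_iff fun a b hab => Fin.ext (by simpa using shiftSeq_injective hn τ hc hab)]
  intro i j
  simp only [zero_add]
  rw [shiftSeq_of_lt, shiftSeq_of_lt]
  exact_mod_cast Iff.rfl

/-- The first and the last window of the path along one period of `shiftSeq` agree. -/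
theorem vert_last_seqPath_shiftSeq {n : ℕ} (hn : 0 < n) (τ : Perm (Fin n)) {c : ℤ} (hc : c ≠ 0) :
    (seqPath m _ (shiftSeq_injective hn τ hc) n).vert (Fin.last _) =
      (seqPath m _ (shiftSeq_injective hn τ hc) n).vert 0 := by
  change orderPattern (fun i : Fin m => shiftSeq hn τ c (n + i)) =
    orderPattern (fun i : Fin m => shiftSeq hn τ c (0 + i))
  have hinj : ∀ k, Function.Injective fun i : Fin m => shiftSeq hn τ c (k + i) :=
    fun k a b hab => Fin.ext (by simpa using shiftSeq_injective hn τ hc hab)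
  rw [orderPattern_eq_iff (hinj n)]
  intro i j
  rw [orderPattern_lt_iff _ (hinj 0), shiftSeq_add, shiftSeq_add, zero_add, zero_add]
  exact add_lt_add_iff_right _

/-- Repeating an edge as a pattern, with copies shifted upwards, traces a closed path through it.
Repeating a vertex in the same way gives an edge leaving it, except for `m = 0`, where there is no
period to repeat. -/
theorem isFaceSubgraph_fullSubgraph (m : ℕ) : (fullSubgraph m).IsFaceSubgraph := by
  constructor
  · intro v _
    rcases Nat.eq_zero_or_pos m with rfl | hm
    · exact ⟨1, trivial, .inl (Subsingleton.elim _ _)⟩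
    · let γ := seqPath m _ (shiftSeq_injective hm v one_ne_zero) 1
      refine ⟨γ.edge (0 : Fin 1), trivial, .inl ((γ.head_edge (0 : Fin 1)).trans ?_)⟩
      exact orderPattern_shiftSeq hm v one_ne_zero
  · intro e _
    let γ := seqPath m _ (shiftSeq_injective m.succ_pos e one_ne_zero) (m + 1)
    refine ⟨γ.vert 0, γ, ⟨rfl, vert_last_seqPath_shiftSeq _ _ one_ne_zero⟩, ⟨fun _ => trivial, fun _ => trivial⟩,
      (0 : Fin (m + 1)), ?_⟩
    exact orderPattern_shiftSeq m.succ_pos e one_ne_zero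

/-- Repeating the pattern `v` with upward shifts gives a loop at `v` that raises every entry;
downward shifts give one that lowers every entry. Neither sign can be common to both loops. -/
theorem driftless_fullSubgraph (m : ℕ) : Driftless (fullSubgraph m) := by
  rintro ⟨v', -, v, hv, j, ε, hε, hall⟩
  have hm : 0 < m := j.pos
  have hloop : ∀ c : ℤ, ∀ hc : c ≠ 0,
      drift (seqPath m _ (shiftSeq_injective hm v hc) m) j j = ε := by
    intro c hc
    have h0 : (seqPath m _ (shiftSeq_injective hm v hc) m).vert 0 = v := orderPattern_shiftSeq hm v hc
    refine hall _ ⟨h0, (vert_last_seqPath_shiftSeq hm v hc).trans h0⟩ ?_ hm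
    refine Path.isIn_of_edges _ _ (by rw [h0]; exact hv) ?_
    exact (Path.isWalk_edges _).mem_component (fun _ _ => trivial) (by rw [h0]; exact hv.2)
  have hpos : (0 : ℤ) < m := by exact_mod_cast hm
  have h1 := (drift_seqPath_ne (m := m) (shiftSeq_injective hm v (c := 1) one_ne_zero) m j).2
    (by rw [shiftSeq_add]; linarith)
  have h2 := (drift_seqPath_ne (m := m) (shiftSeq_injective hm v (c := -1) (by norm_num)) m j).1
    (by rw [shiftSeq_add]; linarith)
  rw [hloop _ one_ne_zero] at h1
  rw [hloop _ (by norm_num)] at h2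
  cases ε with
  | zero => exact hε rfl
  | pos => exact h2 rfl
  | neg => exact h1 rfl

/-! ### Assembling the description of the realizable distributions -/

theorem realizable_eq_iUnion (m : ℕ) :
    realizable (m + 1) = ⋃ F ∈ {F | ∃ H : (permDigraph m).Subgraph, H.IsFaceSubgraph ∧
      Driftless H ∧ F = H.face}, intrinsicInterior ℝ F := by
  ext φ
  simp only [Set.mem_iUnion, exists_prop]
  constructor
  · rintro ⟨f, hf, rfl⟩
    have hP := orderDist_mem_flowPolytope (m := m) hf
    obtain ⟨h0, -, hflow⟩ := mem_flowPolytope.1 hP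
    have hface := hflow.isFaceSubgraph h0
    -- A realizable distribution lies in the relative interior of the face of its own support.
    refine ⟨_, ⟨_, hface, driftless_supportSubgraph hf, rfl⟩, ?_⟩
    rw [hface.intrinsicInterior_face]
    exact ⟨⟨hP, fun e he => le_antisymm (not_lt.1 he) (h0 e)⟩, fun e he => he⟩
  · rintro ⟨_, ⟨H, hH, hD, rfl⟩, hφ⟩
    rw [hH.intrinsicInterior_face] at hφ
    exact hD.mem_realizable hH hφ.1 hφ.2

end OrderPatterns

end

open OrderPatterns in
/-- Here `m = n - 1`: the patterns have length `n = m + 1`, and the digraph is `G_{n-1} = G_m`.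
Faces of the polytope are its exposed subsets (including the empty face), and an open face is the
relative interior of a face. -/
theorem theorem5 (m : ℕ) :
    (∃ 𝓕 : Set (Set (Equiv.Perm (Fin (m + 1)) → ℝ)),
      (∀ F ∈ 𝓕, IsExposed ℝ (permDigraph m).flowPolytope F) ∧
      realizable (m + 1) = ⋃ F ∈ 𝓕, intrinsicInterior ℝ F) ∧
    ((∀ F : Set (Equiv.Perm (Fin (m + 1)) → ℝ), IsExposed ℝ (permDigraph m).flowPolytope F →
        ∃! H : (permDigraph m).Subgraph, H.IsFaceSubgraph ∧ F = H.face) ∧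
      ∀ H : (permDigraph m).Subgraph, H.IsFaceSubgraph →
        IsExposed ℝ (permDigraph m).flowPolytope H.face ∧
        (intrinsicInterior ℝ H.face ⊆ realizable (m + 1) ↔ Driftless H)) ∧
    closure (realizable (m + 1)) = (permDigraph m).flowPolytope := by
  refine ⟨⟨_, ?_, realizable_eq_iUnion m⟩, ⟨fun F hF => ?_, fun H hH => ⟨H.isExposed_face, ?_⟩⟩, ?_⟩
  · rintro _ ⟨H, -, -, rfl⟩
    exact H.isExposed_face
  · obtain ⟨H, hH, rfl⟩ := MultiDigraph.exists_face_of_isExposed hF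
    exact ⟨H, ⟨hH, rfl⟩, fun K ⟨hK, h⟩ => hK.face_injective hH h.symm⟩
  · rw [hH.intrinsicInterior_face]
    refine ⟨fun h => ?_, fun hD φ hφ => hD.mem_realizable hH hφ.1 hφ.2⟩
    -- Without edges the open face is empty and the inclusion says nothing, but then `H` has no
    -- vertices and is vacuously driftless.
    rcases H.edges.eq_empty_or_nonempty with he | hne
    · rintro ⟨v, hv, -⟩
      obtain ⟨e, he', -⟩ := hH.1 v hv
      simp [he] at he'
    · obtain ⟨φ, hφ, hp⟩ := hH.exists_pos hne
      -- One realizable point of the open face is enough, because its support is exactly `H`.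
      obtain ⟨f, hf, rfl⟩ := h ⟨hφ, hp⟩
      rw [hH.eq_supportSubgraph hφ hp]
      exact driftless_supportSubgraph hf
  · apply Set.Subset.antisymm
    · refine closure_minimal ?_ (MultiDigraph.isClosed_flowPolytope _)
      rintro _ ⟨f, hf, rfl⟩
      exact orderDist_mem_flowPolytope hf
    -- Flows positive on every edge are realizable by driftlessness of the whole digraph, and they
    -- are dense as soon as one exists.
    · obtain ⟨φ₀, h₀, hp⟩ := (isFaceSubgraph_fullSubgraph m).exists_pos ⟨1, trivial⟩
      refine (MultiDigraph.subset_closure_pos h₀.1 fun e => hp e trivial).trans (closure_mono ?_)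
      rintro φ ⟨hφ, hpos⟩
      exact (driftless_fullSubgraph m).mem_realizable (isFaceSubgraph_fullSubgraph m)
        ⟨hφ, fun e he => absurd trivial he⟩ fun e _ => hpos e
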